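/- **Theorem 4.1.** Let $n\ge 1$ and let $v_1,\dots,v_n,d$ be positive integers with $\gcd(v_1,\dots,v_n,d)=1$ and $v_i\le d/2$ for all $i$. Let $f\in\mathbb{C}[x_1,\dots,x_n]$ be quasihomogeneous with weight system $(v_1,\dots,v_n,d)$, i.e. $\sum_i\alpha_iv_i=d$ for every monomial $x^\alpha$ occurring in $f$, and suppose that $f$ has an isolated singularity at $0$, i.e. the partial derivatives $\partial f/\partial x_1,\dots,\partial f/\partial x_n$ vanish simultaneously precisely at $0\in\mathbb{C}^n$. Let $$\mu=\dim_{\mathbb{C}}\ \mathcal{O}_{\mathbb{C}^n,0}\Big/\Big(\frac{\partial f}{\partial x_1},\dots,\frac{\partial f}{\partial x_n}\Big)$$ be the Milnor number of $f$, where $\mathcal{O}_{\mathbb{C}^n,0}$ is the ring of germs at $0$ of holomorphic functions, and for $m\ge 0$ let $$l(m)=\prod_{i=1}^{m}\frac{p_i}{p_i-1},$$ where $p_i$ is the $i$-th prime number ($p_1=2$, $p_2=3$, …). (a) Then $d\le l(n)\cdot\mu$. (b) If moreover $n\ge 2$ and $v_i<d/2$ for all $i$, then $d\le l(n-1)\cdot\mu$.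 -/

import Mathlib

open scoped Topology

noncomputable section

/-- Germs at a filter of complex-valued functions form a `ℂ`-algebra, with pointwise operations
(extending the module structure that Mathlib has on germs). -/
instance germAlgebra {α : Type*} (l : Filter α) : Algebra ℂ (l.Germ ℂ) :=
  Algebra.ofModule
    (fun r x y => Quotient.inductionOn₂' x y fun F G =>
      congrArg (Filter.Germ.ofFun (l := l)) (smul_mul_assoc r F G))
    (fun r x y => Quotient.inductionOn₂' x y fun F G =>
      congrArg (Filter.Germ.ofFun (l := l)) (mul_smul_comm r F G))

/-- The ring `𝒪_{ℂⁿ,0}` of germs at `0` of holomorphic (that is, complex analytic) functions on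
`ℂⁿ`, as a `ℂ`-subalgebra of the algebra of germs at `0` of all functions `ℂⁿ → ℂ`. -/
def analyticGerms (n : ℕ) : Subalgebra ℂ (Filter.Germ (𝓝 (0 : Fin n → ℂ)) ℂ) where
  carrier := {g | ∃ F : (Fin n → ℂ) → ℂ, AnalyticAt ℂ F 0 ∧ g = Filter.Germ.ofFun F}
  mul_mem' := by
    rintro _ _ ⟨F, hF, rfl⟩ ⟨G, hG, rfl⟩
    exact ⟨F * G, hF.mul hG, rfl⟩
  add_mem' := by
    rintro _ _ ⟨F, hF, rfl⟩ ⟨G, hG, rfl⟩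
    exact ⟨F + G, hF.add hG, rfl⟩
  algebraMap_mem' := fun c => ⟨fun _ => c * 1, analyticAt_const, rfl⟩

/-- A polynomial function is analytic. -/
theorem analyticAt_polynomialFunction {n : ℕ} (p : MvPolynomial (Fin n) ℂ) :
    AnalyticAt ℂ (fun x : Fin n → ℂ => MvPolynomial.eval x p) 0 := by
  induction p using MvPolynomial.induction_on with
  | C a => simpa using analyticAt_const
  | add p q hp hq =>
    simp only [map_add]
    exact hp.add hq
  | mul_X p i hp =>
    simp only [map_mul, MvPolynomial.eval_X]
    exact hp.mul ((ContinuousLinearMap.proj (R := ℂ) (φ := fun _ : Fin n => ℂ) i).analyticAt 0)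

/-- The germ at `0` of the function on `ℂⁿ` given by a polynomial. -/
def polynomialGerm {n : ℕ} (p : MvPolynomial (Fin n) ℂ) : analyticGerms n :=
  ⟨Filter.Germ.ofFun fun x : Fin n → ℂ => MvPolynomial.eval x p,
    _, analyticAt_polynomialFunction p, rfl⟩

/-- The Jacobian ideal `J_f = (∂f/∂x₁, …, ∂f/∂xₙ) ⊆ 𝒪_{ℂⁿ,0}`. -/
def jacobianIdeal {n : ℕ} (f : MvPolynomial (Fin n) ℂ) : Ideal (analyticGerms n) :=
  Ideal.span (Set.range fun i => polynomialGerm (MvPolynomial.pderiv i f))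

/-- The Milnor number `μ = dim_ℂ 𝒪_{ℂⁿ,0} / J_f` of `f` at `0` (with the value `0` if the
dimension is infinite). -/
def milnorNumber {n : ℕ} (f : MvPolynomial (Fin n) ℂ) : ℕ :=
  Module.finrank ℂ (analyticGerms n ⧸ jacobianIdeal f)

/-- `f` has an isolated singularity at `0`: its partial derivatives vanish simultaneously
precisely at `0`. -/
def HasIsolatedSingularityAtZero {n : ℕ} (f : MvPolynomial (Fin n) ℂ) : Prop :=
  ∀ x : Fin n → ℂ, (∀ i, MvPolynomial.eval x (MvPolynomial.pderiv i f) = 0) ↔ x = 0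

/-- `l(n) = ∏_{i=1}^n p_i / (p_i - 1)`, where `p_i` is the `i`-th prime number
(`Nat.nth Nat.Prime 0 = 2`). -/
def primeRatioProduct (n : ℕ) : ℚ :=
  ∏ i ∈ Finset.range n, (Nat.nth Nat.Prime i : ℚ) / ((Nat.nth Nat.Prime i : ℚ) - 1)

end

/-! The proof separates geometry from arithmetic. Geometry enters twice. First, `μ ≥ ∏ (d - v i) / v
i`; equality is not needed. By the Nullstellensatz the Jacobian ideal contains a power of the ideal
of the variables, so `μ` can be computed with polynomials instead of germs. The partials `g i` are
quasihomogeneous of degrees `u i = d - v i`, and every polynomial is a combination of `μ` monomials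
with coefficients in `ℂ[g]`. Up to weighted degree `D` there are about `D^n / (n! ∏ v i)` monomials
in `x` and about `D^n / (n! ∏ u i)` in the `g i`, so comparing growth gives `∏ u i ≤ μ ∏ v i`.
Second, an isolated singularity forces a relation `a i * v i + v (κ i) = d` for each `i`.

The rest is arithmetic of the weights `w i = v i / d` on the graph of `κ`. A `Cover` of all indices
yields moduli `b u ≥ 2` and a factor `E` such that `E * lcm b` clears all denominators, hence is a
multiple of `d` because the weights are reduced, while `E * ∏ (b u - 1) ≤ ∏ (1 - w j) / w j`. It
remains to compare `lcm b` with `∏ (b u - 1)`: the ratio is at most `∏ b s / (b s - 1)` over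
pairwise coprime `b s`, and replacing each `b s` by a prime divisor bounds this by `l`.

For (b), fewer than `n` coprime moduli already suffice. With `n` of them, every `b s` satisfies `b s
* w j = 1` for some `j`, so `b s ≥ 3`, and excluding the modulus `2` saves one factor. -/

noncomputable section

/-! ### Analytic germs and polynomials modulo powers of the maximal ideal -/

/-- Hadamard's lemma for analytic functions of several variables. -/
theorem AnalyticAt.exists_eq_add_sum_mul {n : ℕ} {F : (Fin n → ℂ) → ℂ} (hF : AnalyticAt ℂ F 0) :
    ∃ G : Fin n → (Fin n → ℂ) → ℂ, (∀ i, AnalyticAt ℂ (G i) 0) ∧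
      F =ᶠ[𝓝 0] fun x => F 0 + ∑ i, x i * G i x := by
  obtain ⟨p, r, hp⟩ := hF
  have hrad : 0 < p.shift.radius := by
    rw [FormalMultilinearSeries.radius_shift]
    exact lt_of_lt_of_le hp.r_pos hp.r_le
  have hshift := p.shift.hasFPowerSeriesOnBall hrad
  have hun := hshift.unshift (z := F 0)
  -- Shifting `p` and restoring its constant term gives `p` back. Thus `F x = F 0 + T x x` near `0`
  -- with `T` analytic and valued in linear functionals; the cofactors are the values of `T` on the
  -- basis vectors.
  have hser : p.shift.unshift (F 0) = p := by
    ext1 k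
    cases k with
    | zero =>
      ext v
      simp [FormalMultilinearSeries.unshift, hp.hasFPowerSeriesAt.coeff_zero v]
    | succ k =>
      exact LinearIsometryEquiv.symm_apply_apply
        (continuousMultilinearCurryRightEquiv' ℂ k (Fin n → ℂ) ℂ) (p (k + 1))
  rw [hser] at hun
  refine ⟨fun i x => p.shift.sum x (Pi.single i 1), fun i => ?_, ?_⟩
  · exact (ContinuousLinearMap.apply ℂ ℂ (Pi.single i (1 : ℂ) : Fin n → ℂ)).analyticAt _ |>.comp
      hshift.analyticAt
  · have h := hp.hasFPowerSeriesAt.eventually_hasSum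
    have h' := hun.hasFPowerSeriesAt.eventually_hasSum
    filter_upwards [h, h'] with x hx hx'
    have := hx.unique hx'
    simp only [zero_add, sub_zero] at this
    rw [this]
    congr 1
    generalize p.shift.sum x = T
    conv_lhs => rw [pi_eq_sum_univ' x, map_sum]
    exact Finset.sum_congr rfl fun i _ => by rw [map_smul, smul_eq_mul]

/-- The homomorphism sending a polynomial to its germ at `0`. -/
def polynomialGermHom (n : ℕ) : MvPolynomial (Fin n) ℂ →ₐ[ℂ] analyticGerms n where
  toFun := polynomialGerm
  map_one' := Subtype.ext (congrArg Filter.Germ.ofFun (funext fun x => map_one _))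
  map_mul' p q := Subtype.ext (congrArg Filter.Germ.ofFun (funext fun x => map_mul _ p q))
  map_zero' := Subtype.ext (congrArg Filter.Germ.ofFun (funext fun x => map_zero _))
  map_add' p q := Subtype.ext (congrArg Filter.Germ.ofFun (funext fun x => map_add _ p q))
  commutes' c := by
    rw [Algebra.algebraMap_eq_smul_one, Algebra.algebraMap_eq_smul_one]
    exact Subtype.ext (congrArg Filter.Germ.ofFun (funext fun x => by
      simp [MvPolynomial.smul_eval]))

theorem jacobianIdeal_eq_map {n : ℕ} (f : MvPolynomial (Fin n) ℂ) :
    jacobianIdeal f = (Ideal.span (Set.range fun i => MvPolynomial.pderiv i f)).map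
      (polynomialGermHom n) := by
  rw [Ideal.map_span, ← Set.range_comp]
  rfl

/-- Iterated Hadamard lemma: split off the constant term, approximate the cofactors to order `N`,
and gain one order from the coordinate factor. -/
theorem exists_sub_polynomialGermHom_mem_pow {n : ℕ} (N : ℕ) (g : analyticGerms n) :
    ∃ p, g - polynomialGermHom n p ∈
      ((MvPolynomial.idealOfVars (Fin n) ℂ).map (polynomialGermHom n)) ^ N := by
  induction N generalizing g with
  | zero => exact ⟨0, by simp⟩
  | succ N ih =>
    obtain ⟨_, F, hF, rfl⟩ := g
    obtain ⟨G, hG, hFG⟩ := hF.exists_eq_add_sum_mul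
    let g' : Fin n → analyticGerms n := fun i => ⟨_, G i, hG i, rfl⟩
    choose p hp using fun i => ih (g' i)
    refine ⟨MvPolynomial.C (F 0) + ∑ i, MvPolynomial.X i * p i, ?_⟩
    have key : (⟨Filter.Germ.ofFun F, F, hF, rfl⟩ : analyticGerms n) =
        polynomialGermHom n (MvPolynomial.C (F 0)) +
          ∑ i, polynomialGermHom n (MvPolynomial.X i) * g' i := by
      apply Subtype.ext
      have hsum : ∀ s : Finset (Fin n),
          ((∑ i ∈ s, polynomialGermHom n (MvPolynomial.X i) * g' i : analyticGerms n) :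
            Filter.Germ (𝓝 (0 : Fin n → ℂ)) ℂ) =
          Filter.Germ.ofFun fun x => ∑ i ∈ s, x i * G i x := by
        classical
        intro s
        induction s using Finset.induction_on with
        | empty => rfl
        | insert a s ha ih =>
          rw [Finset.sum_insert ha, AddMemClass.coe_add, ih]
          refine congrArg Filter.Germ.ofFun (funext fun x => ?_)
          simp [Finset.sum_insert ha]
      rw [AddMemClass.coe_add, hsum]
      refine (Filter.Germ.coe_eq.2 ?_ : (F : Filter.Germ (𝓝 (0 : Fin n → ℂ)) ℂ) = _)
      filter_upwards [hFG] with x hx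
      simpa using hx
    rw [key, map_add, map_sum, add_sub_add_left_eq_sub, ← Finset.sum_sub_distrib]
    refine Ideal.sum_mem _ fun i _ => ?_
    rw [map_mul, ← mul_sub, pow_succ']
    refine Ideal.mul_mem_mul (Ideal.mem_map_of_mem _ ?_) (hp i)
    exact Ideal.subset_span ⟨i, rfl⟩

/-- The ideal of analytic germs that are `O(‖x‖ ^ N)` at `0`. -/
def bigOIdeal (n N : ℕ) : Ideal (analyticGerms n) where
  carrier := {g | ∃ F, g.1 = Filter.Germ.ofFun F ∧ F =O[𝓝 0] fun x : Fin n → ℂ => ‖x‖ ^ N}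
  add_mem' := by
    rintro _ _ ⟨F, hF, hF'⟩ ⟨G, hG, hG'⟩
    exact ⟨F + G, by rw [AddMemClass.coe_add, hF, hG]; rfl, hF'.add hG'⟩
  zero_mem' := ⟨0, rfl, Asymptotics.isBigO_zero _ _⟩
  smul_mem' := by
    rintro ⟨_, G, hG, rfl⟩ b ⟨F, hF, hF'⟩
    refine ⟨G * F, by rw [smul_eq_mul, MulMemClass.coe_mul, hF]; rfl, ?_⟩
    have := (hG.continuousAt.norm.isBoundedUnder_le).isBigO_one ℝ |>.mul hF'
    simp only [one_mul] at this
    exact this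

theorem map_idealOfVars_pow_le_bigOIdeal (n N : ℕ) :
    ((MvPolynomial.idealOfVars (Fin n) ℂ).map (polynomialGermHom n)) ^ N ≤ bigOIdeal n N := by
  have h1 : (MvPolynomial.idealOfVars (Fin n) ℂ).map (polynomialGermHom n) ≤ bigOIdeal n 1 := by
    rw [MvPolynomial.idealOfVars, Ideal.map_span, Ideal.span_le]
    rintro _ ⟨_, ⟨i, rfl⟩, rfl⟩
    refine ⟨_, rfl, ?_⟩
    refine Asymptotics.IsBigO.of_bound 1 (Filter.Eventually.of_forall fun x => ?_)
    simpa using norm_le_pi_norm x i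
  induction N with
  | zero =>
    rintro ⟨_, F, hF, rfl⟩ -
    refine ⟨F, rfl, ?_⟩
    simpa using (hF.continuousAt.norm.isBoundedUnder_le).isBigO_one ℝ
  | succ N ih =>
    rw [pow_succ, Ideal.mul_le]
    intro a ha b hb
    obtain ⟨F, hF, hF'⟩ := ih ha
    obtain ⟨G, hG, hG'⟩ := h1 hb
    refine ⟨F * G, by rw [MulMemClass.coe_mul, hF, hG]; rfl, ?_⟩
    have := hF'.mul hG'
    simp only [← pow_add] at this
    exact this

theorem Polynomial.coeff_eq_zero_of_isBigO {q : Polynomial ℂ} {N : ℕ}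
    (hq : (fun t => q.eval t) =O[𝓝 0] fun t : ℂ => ‖t‖ ^ N) {k : ℕ} (hk : k < N) :
    q.coeff k = 0 := by
  induction k using Nat.strong_induction_on with
  | _ k ih =>
    obtain ⟨r, rfl⟩ : Polynomial.X ^ k ∣ q :=
      Polynomial.X_pow_dvd_iff.2 fun m hm => ih m hm (hm.trans hk)
    -- Dividing by `t ^ k` is only possible off `0`; since `N - k > 0`, the quotient tends to `0`,
    -- and by continuity so does its constant term.
    have hr : (fun t => r.eval t) =O[𝓝[≠] 0] fun t : ℂ => ‖t‖ ^ (N - k) := by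
      obtain ⟨c, hc⟩ := (hq.mono (nhdsWithin_le_nhds (s := {(0 : ℂ)}ᶜ))).bound
      refine Asymptotics.IsBigO.of_bound c ?_
      filter_upwards [hc, self_mem_nhdsWithin] with t ht ht0
      have hpos : 0 < ‖t‖ ^ k := pow_pos (norm_pos_iff.2 ht0) k
      refine le_of_mul_le_mul_left ?_ hpos
      have e : N = k + (N - k) := by omega
      rw [e] at ht
      simp only [Polynomial.eval_mul, Polynomial.eval_pow, Polynomial.eval_X, norm_mul, norm_pow,
        norm_norm, pow_add] at ht ⊢
      linarith
    have h0 : Filter.Tendsto (fun t : ℂ => ‖t‖ ^ (N - k)) (𝓝[≠] 0) (𝓝 0) := by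
      have : Filter.Tendsto (fun t : ℂ => ‖t‖ ^ (N - k)) (𝓝 0) (𝓝 (‖(0 : ℂ)‖ ^ (N - k))) :=
        (continuous_norm.pow _).tendsto 0
      rw [norm_zero, zero_pow (by omega)] at this
      exact this.mono_left nhdsWithin_le_nhds
    have h2 : Filter.Tendsto (fun t => r.eval t) (𝓝[≠] 0) (𝓝 (r.eval 0)) :=
      (r.continuous.tendsto 0).mono_left nhdsWithin_le_nhds
    have h3 : r.eval 0 = 0 := tendsto_nhds_unique h2 (hr.trans_tendsto h0)
    simpa [Polynomial.coeff_X_pow_mul', Polynomial.coeff_zero_eq_eval_zero] using h3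

/-- Restrict `p` to the line `t ↦ t x`: the coefficient of `t ^ k` is the value at `x` of the
component of degree `k`, which reduces the claim to one variable. -/
theorem mem_pow_idealOfVars_of_isBigO {n N : ℕ} {p : MvPolynomial (Fin n) ℂ}
    (hp : (fun x : Fin n → ℂ => MvPolynomial.eval x p) =O[𝓝 0] fun x => ‖x‖ ^ N) :
    p ∈ MvPolynomial.idealOfVars (Fin n) ℂ ^ N := by
  classical
  rw [MvPolynomial.mem_pow_idealOfVars_iff']
  intro α hα
  suffices h : MvPolynomial.homogeneousComponent α.degree p = 0 by
    have := congrArg (MvPolynomial.coeff α) h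
    rwa [MvPolynomial.coeff_homogeneousComponent, if_pos rfl] at this
  refine MvPolynomial.funext fun x => ?_
  let q : Polynomial ℂ := MvPolynomial.aeval (fun i => Polynomial.C (x i) * Polynomial.X) p
  have hq : ∀ t, q.eval t = MvPolynomial.eval (fun i => x i * t) p := fun t => by
    have h := MvPolynomial.eval₂_comp_left (Polynomial.evalRingHom t) Polynomial.C
      (fun i => Polynomial.C (x i) * Polynomial.X) p
    simp only [Polynomial.coe_evalRingHom] at h
    change Polynomial.eval t (MvPolynomial.eval₂ _ _ p) = _
    rw [Polynomial.algebraMap_eq, h, MvPolynomial.eval, MvPolynomial.coe_eval₂Hom]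
    congr 1
    · ext; simp
    · ext i; simp
  have hbig : (fun t => q.eval t) =O[𝓝 0] fun t : ℂ => ‖t‖ ^ N := by
    have ht : Filter.Tendsto (fun t : ℂ => fun i => x i * t) (𝓝 0) (𝓝 0) := by
      have : Continuous fun t : ℂ => fun i => x i * t := by fun_prop
      have h := this.tendsto 0
      simpa [Pi.zero_def] using h
    have h := hp.comp_tendsto ht
    simp only [Function.comp_def, ← hq] at h
    refine h.trans ?_
    refine Asymptotics.IsBigO.of_bound (‖x‖ ^ N) (Filter.Eventually.of_forall fun t => ?_)
    have : (fun i => x i * t) = t • x := by ext i; simp [mul_comm]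
    rw [this, norm_smul]
    simp [mul_pow, mul_comm]
  have hcoeff : q.coeff α.degree = MvPolynomial.eval x
      (MvPolynomial.homogeneousComponent α.degree p) := by
    have e : q = ∑ β ∈ p.support, Polynomial.C (p.coeff β * ∏ i, x i ^ β i) *
        Polynomial.X ^ β.degree := by
      simp only [q, MvPolynomial.aeval_def, MvPolynomial.eval₂_eq']
      refine Finset.sum_congr rfl fun β _ => ?_
      simp only [mul_pow, Finset.prod_mul_distrib, Finset.prod_pow_eq_pow_sum, map_mul, map_prod,
        map_pow, Polynomial.algebraMap_eq, Finsupp.degree_eq_sum, mul_assoc]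
    rw [e, MvPolynomial.homogeneousComponent_apply, map_sum, Polynomial.finsetSum_coeff,
      Finset.sum_filter]
    refine Finset.sum_congr rfl fun β _ => ?_
    rw [Polynomial.coeff_C_mul_X_pow]
    simp only [eq_comm (a := α.degree), MvPolynomial.eval_monomial]
    rw [Finsupp.prod_fintype _ _ (by simp)]
  rw [← hcoeff, Polynomial.coeff_eq_zero_of_isBigO hbig hα, map_zero]

theorem mem_pow_idealOfVars_of_polynomialGermHom_mem {n N : ℕ} {p : MvPolynomial (Fin n) ℂ}
    (hp : polynomialGermHom n p ∈
      ((MvPolynomial.idealOfVars (Fin n) ℂ).map (polynomialGermHom n)) ^ N) :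
    p ∈ MvPolynomial.idealOfVars (Fin n) ℂ ^ N := by
  obtain ⟨F, hF, hF'⟩ := map_idealOfVars_pow_le_bigOIdeal n N hp
  refine mem_pow_idealOfVars_of_isBigO (hF'.congr' ?_ Filter.EventuallyEq.rfl)
  exact (Filter.Germ.coe_eq.1 hF).symm

/-- Modulo the `N`-th power of the maximal ideal, elements of the extended ideal come from `I`
itself. The error is then a polynomial vanishing to order `N`, and `hI` puts it in `I`. This is the
injectivity of the comparison between the two quotients. -/
theorem comap_map_polynomialGermHom {n N : ℕ} {I : Ideal (MvPolynomial (Fin n) ℂ)}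
    (hI : MvPolynomial.idealOfVars (Fin n) ℂ ^ N ≤ I) {p : MvPolynomial (Fin n) ℂ}
    (hp : polynomialGermHom n p ∈ I.map (polynomialGermHom n)) : p ∈ I := by
  have key : ∀ g ∈ I.map (polynomialGermHom n), ∃ q ∈ I, g - polynomialGermHom n q ∈
      ((MvPolynomial.idealOfVars (Fin n) ℂ).map (polynomialGermHom n)) ^ N := by
    intro g hg
    induction hg using Submodule.span_induction with
    | mem x hx =>
      obtain ⟨q, hq, rfl⟩ := hx
      exact ⟨q, hq, by simp⟩
    | zero => exact ⟨0, I.zero_mem, by simp⟩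
    | add x y _ _ hx hy =>
      obtain ⟨q, hq, hq'⟩ := hx
      obtain ⟨r, hr, hr'⟩ := hy
      refine ⟨q + r, I.add_mem hq hr, ?_⟩
      rw [map_add, add_sub_add_comm]
      exact Ideal.add_mem _ hq' hr'
    | smul a x _ hx =>
      obtain ⟨q, hq, hq'⟩ := hx
      obtain ⟨r, hr⟩ := exists_sub_polynomialGermHom_mem_pow N a
      refine ⟨r * q, I.mul_mem_left _ hq, ?_⟩
      have : a • x - polynomialGermHom n (r * q) = a * (x - polynomialGermHom n q) +
          polynomialGermHom n q * (a - polynomialGermHom n r) := by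
        rw [smul_eq_mul, map_mul]; ring
      rw [this]
      exact Ideal.add_mem _ (Ideal.mul_mem_left _ _ hq') (Ideal.mul_mem_left _ _ hr)
  obtain ⟨q, hq, hpq⟩ := key _ hp
  rw [← map_sub] at hpq
  have := I.add_mem (hI (mem_pow_idealOfVars_of_polynomialGermHom_mem hpq)) hq
  rwa [sub_add_cancel] at this

/-- For an ideal that is primary to the origin, passing to analytic germs does not change the
dimension of the quotient. -/
theorem finrank_quotient_map_polynomialGermHom {n N : ℕ} {I : Ideal (MvPolynomial (Fin n) ℂ)}
    (hI : MvPolynomial.idealOfVars (Fin n) ℂ ^ N ≤ I) :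
    Module.finrank ℂ (analyticGerms n ⧸ I.map (polynomialGermHom n)) =
      Module.finrank ℂ (MvPolynomial (Fin n) ℂ ⧸ I) := by
  let ψ := Ideal.quotientMapₐ (I.map (polynomialGermHom n)) (polynomialGermHom n)
    Ideal.le_comap_map
  refine (LinearEquiv.finrank_eq (LinearEquiv.ofBijective ψ.toLinearMap ⟨?_, ?_⟩)).symm
  · rw [← LinearMap.ker_eq_bot, LinearMap.ker_eq_bot']
    intro x hx
    obtain ⟨p, rfl⟩ := Ideal.Quotient.mk_surjective x
    exact Ideal.Quotient.eq_zero_iff_mem.2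
      (comap_map_polynomialGermHom hI (Ideal.Quotient.eq_zero_iff_mem.1 hx))
  · intro y
    obtain ⟨g, rfl⟩ := Ideal.Quotient.mk_surjective y
    obtain ⟨p, hp⟩ := exists_sub_polynomialGermHom_mem_pow N g
    refine ⟨Ideal.Quotient.mk _ p, (Ideal.Quotient.eq.2 ?_).symm⟩
    rw [← Ideal.map_pow] at hp
    exact Ideal.map_mono hI hp


/-! ### Finite codimension of the Jacobian ideal -/

/-- Nullstellensatz: the zero locus is the origin, so the variables lie in the radical, and a
finitely generated ideal inside the radical has a power inside the ideal. -/
theorem exists_pow_idealOfVars_le_span_pderiv {n : ℕ} {f : MvPolynomial (Fin n) ℂ}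
    (hf : HasIsolatedSingularityAtZero f) : ∃ N, MvPolynomial.idealOfVars (Fin n) ℂ ^ N ≤
      Ideal.span (Set.range fun i => MvPolynomial.pderiv i f) := by
  set I := Ideal.span (Set.range fun i => MvPolynomial.pderiv i f) with hI
  have hz : MvPolynomial.zeroLocus ℂ I = {0} := by
    ext x
    rw [hI, MvPolynomial.zeroLocus_span, Set.mem_singleton_iff, ← hf x]
    simp [MvPolynomial.aeval_eq_eval]
  have hrad : MvPolynomial.idealOfVars (Fin n) ℂ ≤ I.radical := by
    rw [← MvPolynomial.vanishingIdeal_zeroLocus_eq_radical (K := ℂ), hz,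
      MvPolynomial.idealOfVars, Ideal.span_le]
    rintro _ ⟨i, rfl⟩
    simp
  obtain ⟨N, hN⟩ := I.exists_radical_pow_le_of_fg (IsNoetherian.noetherian _)
  exact ⟨N, (Ideal.pow_right_mono hrad N).trans hN⟩

theorem span_range_mk_monomial {n : ℕ} (I : Ideal (MvPolynomial (Fin n) ℂ)) :
    Submodule.span ℂ (Set.range fun α : Fin n →₀ ℕ =>
      Ideal.Quotient.mk I (MvPolynomial.monomial α 1)) = ⊤ := by
  rw [eq_top_iff]
  rintro x -
  obtain ⟨p, rfl⟩ := Ideal.Quotient.mk_surjective x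
  rw [p.as_sum, map_sum]
  refine Submodule.sum_mem _ fun α _ => ?_
  have : MvPolynomial.monomial α (p.coeff α) = p.coeff α • MvPolynomial.monomial α (1 : ℂ) := by
    rw [MvPolynomial.smul_monomial, smul_eq_mul, mul_one]
  rw [this]
  exact Submodule.smul_mem _ _ (Submodule.subset_span (Set.mem_range_self α))

theorem finite_quotient_of_pow_idealOfVars_le {n N : ℕ} {I : Ideal (MvPolynomial (Fin n) ℂ)}
    (hI : MvPolynomial.idealOfVars (Fin n) ℂ ^ N ≤ I) :
    Module.Finite ℂ (MvPolynomial (Fin n) ℂ ⧸ I) := by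
  refine Module.finite_def.2 ?_
  rw [← span_range_mk_monomial I]
  have hfin : (Set.range fun α : Fin n →₀ ℕ =>
      Ideal.Quotient.mk I (MvPolynomial.monomial α (1 : ℂ))).Finite := by
    refine (((Finsupp.finite_of_degree_lt (σ := Fin n) N).image fun α =>
      Ideal.Quotient.mk I (MvPolynomial.monomial α (1 : ℂ))).union
        (Set.finite_singleton 0)).subset ?_
    rintro _ ⟨α, rfl⟩
    by_cases h : α.degree < N
    · exact Or.inl ⟨α, h, rfl⟩
    · refine Or.inr (Ideal.Quotient.eq_zero_iff_mem.2 (hI ?_))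
      rw [MvPolynomial.monomial_mem_pow_idealOfVars_iff _ _ one_ne_zero]
      omega
  exact Submodule.fg_span hfin

/-! ### Counting exponents in weighted simplices -/

/-- The exponents of weighted degree at most `D`. -/
def simplexPoints {n : ℕ} (w : Fin n → ℕ) (D : ℕ) : Finset (Fin n → ℕ) :=
  (Fintype.piFinset fun _ => Finset.range (D + 1)).filter fun α => ∑ i, α i * w i ≤ D

theorem mem_simplexPoints {n : ℕ} {w : Fin n → ℕ} (hw : ∀ i, 0 < w i) {D : ℕ} {α : Fin n → ℕ} :
    α ∈ simplexPoints w D ↔ ∑ i, α i * w i ≤ D := by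
  refine ⟨fun h => (Finset.mem_filter.1 h).2, fun h => Finset.mem_filter.2 ⟨?_, h⟩⟩
  refine Fintype.mem_piFinset.2 fun i => Finset.mem_range.2 (Nat.lt_succ_of_le ?_)
  calc α i ≤ α i * w i := Nat.le_mul_of_pos_right _ (hw i)
    _ ≤ ∑ i, α i * w i :=
      Finset.single_le_sum (f := fun i => α i * w i) (fun _ _ => Nat.zero_le _) (Finset.mem_univ i)
    _ ≤ D := h

/-- Division with remainder by `v i` in each coordinate is injective, and the quotients have
weighted degree at most `D`. -/
theorem card_simplexPoints_one_le {n : ℕ} {v : Fin n → ℕ} (hv : ∀ i, 0 < v i) (D : ℕ) :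
    (simplexPoints (n := n) (fun _ => 1) D).card ≤ (∏ i, v i) * (simplexPoints v D).card := by
  have h : (∏ i, v i) * (simplexPoints v D).card =
      ((Fintype.piFinset fun i => Finset.range (v i)) ×ˢ simplexPoints v D).card := by
    rw [Finset.card_product, Fintype.card_piFinset]
    simp
  rw [h]
  refine Finset.card_le_card_of_injOn (fun α => (fun i => α i % v i, fun i => α i / v i)) ?_ ?_
  · intro α hα
    have hα := (mem_simplexPoints (fun _ => one_pos)).1 hα
    refine Finset.mem_product.2 ⟨Fintype.mem_piFinset.2 fun i => ?_, (mem_simplexPoints hv).2 ?_⟩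
    · exact Finset.mem_range.2 (Nat.mod_lt _ (hv i))
    · refine le_trans (Finset.sum_le_sum fun i _ => ?_) hα
      rw [mul_one]
      exact Nat.div_mul_le_self _ _
  · intro α _ β _ hαβ
    obtain ⟨h1, h2⟩ := Prod.mk.inj hαβ
    funext i
    rw [← Nat.mod_add_div (α i) (v i), ← Nat.mod_add_div (β i) (v i), congrFun h1 i, congrFun h2 i]

/-- The inverse of division with remainder; the remainders raise the degree by at most `∑ u i`. -/
theorem prod_mul_card_simplexPoints_le {n : ℕ} {u : Fin n → ℕ} (hu : ∀ i, 0 < u i) (D : ℕ) :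
    (∏ i, u i) * (simplexPoints u D).card ≤
      (simplexPoints (n := n) (fun _ => 1) (D + ∑ i, u i)).card := by
  have h : (∏ i, u i) * (simplexPoints u D).card =
      ((Fintype.piFinset fun i => Finset.range (u i)) ×ˢ simplexPoints u D).card := by
    rw [Finset.card_product, Fintype.card_piFinset]
    simp
  rw [h]
  refine Finset.card_le_card_of_injOn (fun x i => x.1 i + u i * x.2 i) ?_ ?_
  · intro x hx
    obtain ⟨h1, h2⟩ := Finset.mem_product.1 hx
    have h1 := Fintype.mem_piFinset.1 h1
    have h2 := (mem_simplexPoints hu).1 h2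
    refine (mem_simplexPoints (fun _ => one_pos)).2 ?_
    simp only [mul_one, Finset.sum_add_distrib]
    rw [add_comm]
    refine add_le_add (le_trans (le_of_eq ?_) h2) (Finset.sum_le_sum fun i _ => ?_)
    · exact Finset.sum_congr rfl fun i _ => mul_comm _ _
    · exact (Finset.mem_range.1 (h1 i)).le
  · intro x hx y hy hxy
    have hx := Fintype.mem_piFinset.1 (Finset.mem_product.1 hx).1
    have hy := Fintype.mem_piFinset.1 (Finset.mem_product.1 hy).1
    have hmod : x.1 = y.1 := funext fun i => by
      have := congrArg (· % u i) (congrFun hxy i)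
      simpa [Nat.mod_eq_of_lt (Finset.mem_range.1 (hx i)),
        Nat.mod_eq_of_lt (Finset.mem_range.1 (hy i))] using this
    refine Prod.ext hmod (funext fun i => ?_)
    have := congrFun hxy i
    simp only [hmod, add_right_inj] at this
    exact Nat.eq_of_mul_eq_mul_left (hu i) this

/-- Comparing the growth of the numbers of exponents for two weight vectors. -/
theorem prod_le_mul_prod_of_card_simplexPoints_le {n K : ℕ} {u v : Fin n → ℕ}
    (hu : ∀ i, 0 < u i) (hv : ∀ i, 0 < v i)
    (h : ∀ D, (simplexPoints v D).card ≤ K * (simplexPoints u D).card) :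
    ∏ i, u i ≤ K * ∏ i, v i := by
  by_contra! hlt
  set A : ℕ → ℕ := fun D => (simplexPoints (n := n) (fun _ => 1) D).card with hA
  set c := ∑ i, u i
  set P := ∏ i, u i with hP
  set Q := K * ∏ i, v i with hQ
  have hA0 : 1 ≤ A 0 := by
    refine Finset.card_pos.2 ⟨0, ?_⟩
    rw [mem_simplexPoints fun _ => one_pos]
    simp
  -- With `A` the unweighted count, each shift of `D` by `c` multiplies it by at least `P / Q`. If
  -- `P > Q`, iteration gives exponential growth, against the polynomial bound `A D ≤ (D + 1) ^ n`.
  have hstep : ∀ D, P * A D ≤ Q * A (D + c) := fun D => by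
    calc P * A D ≤ P * ((∏ i, v i) * (simplexPoints v D).card) :=
          Nat.mul_le_mul_left _ (card_simplexPoints_one_le hv D)
      _ ≤ P * ((∏ i, v i) * (K * (simplexPoints u D).card)) :=
          Nat.mul_le_mul_left _ (Nat.mul_le_mul_left _ (h D))
      _ = Q * (P * (simplexPoints u D).card) := by rw [hQ]; ring
      _ ≤ Q * A (D + c) := Nat.mul_le_mul_left _ (prod_mul_card_simplexPoints_le hu D)
  have hQpos : 0 < Q := by
    rcases Nat.eq_zero_or_pos Q with h0 | h0
    · have := hstep 0
      rw [h0, zero_mul] at this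
      have : 0 < P * A 0 := Nat.mul_pos (by omega) hA0
      omega
    · exact h0
  have hpow : ∀ k, P ^ k ≤ Q ^ k * A (k * c) := fun k => by
    induction k with
    | zero => simpa using hA0
    | succ k ih =>
      calc P ^ (k + 1) = P * P ^ k := pow_succ' _ _
        _ ≤ P * (Q ^ k * A (k * c)) := Nat.mul_le_mul_left _ ih
        _ = Q ^ k * (P * A (k * c)) := by ring
        _ ≤ Q ^ k * (Q * A (k * c + c)) := Nat.mul_le_mul_left _ (hstep _)
        _ = Q ^ (k + 1) * A ((k + 1) * c) := by rw [add_mul, one_mul]; ring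
  have hAle : ∀ D, A D ≤ (D + 1) ^ n := fun D => by
    refine (Finset.card_filter_le _ _).trans ?_
    simp [Fintype.card_piFinset]
  have hr : (1 : ℝ) < P / Q := by
    rw [one_lt_div (by exact_mod_cast hQpos)]
    exact_mod_cast hlt
  have hlim := tendsto_pow_const_div_const_pow_of_one_lt n hr
  have hb : 0 < 1 / ((c : ℝ) + 1) ^ n / 2 ^ n := by positivity
  obtain ⟨k, hk1, hk⟩ := ((Filter.eventually_ge_atTop 1).and (hlim.eventually_lt_const hb)).exists
  have hk' : ((P : ℝ) / Q) ^ k ≤ ((k : ℝ) * c + 1) ^ n := by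
    rw [div_pow, div_le_iff₀ (by positivity)]
    have := (hpow k).trans (Nat.mul_le_mul_left _ (hAle _))
    rw [mul_comm]
    exact_mod_cast this
  have hkR : (1 : ℝ) ≤ k := by exact_mod_cast hk1
  have h3 : ((k : ℝ) * c + 1) ^ n ≤ (k : ℝ) ^ n * ((c : ℝ) + 1) ^ n * 2 ^ n := by
    rw [← mul_pow, ← mul_pow]
    have hc : (0 : ℝ) ≤ c := Nat.cast_nonneg _
    refine pow_le_pow_left₀ (by positivity) ?_ n
    nlinarith
  have hpos : 0 < ((P : ℝ) / Q) ^ k := pow_pos (by linarith) _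
  rw [div_lt_iff₀ hpos, div_div, one_div, inv_mul_eq_div, lt_div_iff₀ (by positivity)] at hk
  have := (hk'.trans h3)
  linarith

theorem LinearIndependent.card_le_card_of_range_subset_span {R M ι : Type*} [Ring R]
    [StrongRankCondition R] [AddCommGroup M] [Module R M] [Fintype ι] {b : ι → M}
    (hb : LinearIndependent R b) {T : Finset M} (hT : Set.range b ⊆ Submodule.span R (T : Set M)) :
    Fintype.card ι ≤ T.card := by
  have h := linearIndependent_le_span_aux' b hb (T : Set M) hT
  simpa using h

/-! ### The lower bound for the Milnor number -/

section Spanning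

variable {n K : ℕ} (g : Fin n → MvPolynomial (Fin n) ℂ) (e : Fin K → Fin n →₀ ℕ)

/-- Products of one of the monomials with exponents `e j` and of powers of the `g i`. -/
def basisProduct (x : Fin K × (Fin n → ℕ)) : MvPolynomial (Fin n) ℂ :=
  MvPolynomial.monomial (e x.1) 1 * ∏ i, g i ^ x.2 i

/-- The span of the products `basisProduct g e (j, γ)` with `γ` of bounded weighted degree. -/
def boundedSpan (u : Fin n → ℕ) (D : ℕ) : Submodule ℂ (MvPolynomial (Fin n) ℂ) :=
  Submodule.span ℂ (basisProduct g e '' ↑((Finset.univ : Finset (Fin K)) ×ˢ simplexPoints u D))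

variable {g e} {u : Fin n → ℕ}

theorem boundedSpan_mono (hu : ∀ i, 0 < u i) {D D' : ℕ} (h : D ≤ D') :
    boundedSpan g e u D ≤ boundedSpan g e u D' := by
  refine Submodule.span_mono (Set.image_mono ?_)
  intro x hx
  simp only [Finset.coe_product, Finset.coe_univ, Set.mem_prod, Set.mem_univ, true_and,
    Finset.mem_coe, mem_simplexPoints hu] at hx ⊢
  exact hx.trans h

theorem mul_mem_boundedSpan (hu : ∀ i, 0 < u i) {D : ℕ} (i : Fin n) (hi : u i ≤ D)
    {p : MvPolynomial (Fin n) ℂ} (hp : p ∈ boundedSpan g e u (D - u i)) :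
    g i * p ∈ boundedSpan g e u D := by
  classical
  induction hp using Submodule.span_induction with
  | mem x hx =>
    obtain ⟨⟨j, γ⟩, hγ, rfl⟩ := hx
    refine Submodule.subset_span ⟨(j, γ + Pi.single i 1), ?_, ?_⟩
    · simp only [Finset.coe_product, Finset.coe_univ, Set.mem_prod, Set.mem_univ, true_and,
        Finset.mem_coe, mem_simplexPoints hu] at hγ ⊢
      simp only [Pi.add_apply, add_mul, Finset.sum_add_distrib]
      have : ∑ k, (Pi.single i 1 : Fin n → ℕ) k * u k = u i := by
        simp [Pi.single_apply]
      omega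
    · simp only [basisProduct, Pi.add_apply, pow_add, Finset.prod_mul_distrib]
      have : ∏ k, g k ^ (Pi.single i 1 : Fin n → ℕ) k = g i := by
        rw [Finset.prod_eq_single i] <;> simp +contextual
      rw [this]
      ring
  | zero => simp
  | add x y _ _ hx hy => rw [mul_add]; exact Submodule.add_mem _ hx hy
  | smul a x _ hx => rw [mul_smul_comm]; exact Submodule.smul_mem _ _ hx

/-- Take the component of degree `D` in a representation of `p` modulo the `g i`. Only the component
of `h i` of degree `D - u i` contributes, and since `u i > 0` induction applies to it. -/
theorem mem_boundedSpan (hu : ∀ i, 0 < u i) {v : Fin n → ℕ}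
    (hg : ∀ i, (g i).IsWeightedHomogeneous v (u i))
    (he : ∀ p : MvPolynomial (Fin n) ℂ, ∃ (c : Fin K → ℂ) (h : Fin n → MvPolynomial (Fin n) ℂ),
      p = ∑ j, MvPolynomial.monomial (e j) (c j) + ∑ i, g i * h i) (D : ℕ)
    {p : MvPolynomial (Fin n) ℂ} (hp : p.IsWeightedHomogeneous v D) :
    p ∈ boundedSpan g e u D := by
  classical
  let 𝒜 := MvPolynomial.weightedHomogeneousSubmodule ℂ v
  let : GradedAlgebra 𝒜 := MvPolynomial.weightedGradedAlgebra ℂ v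
  induction D using Nat.strong_induction_on generalizing p with
  | _ D ih =>
    obtain ⟨c, h, hch⟩ := he p
    have h1 : p = ∑ j, (DirectSum.decompose 𝒜 (MvPolynomial.monomial (e j) (c j)) D :
          MvPolynomial (Fin n) ℂ) +
        ∑ i, (DirectSum.decompose 𝒜 (g i * h i) D : MvPolynomial (Fin n) ℂ) := by
      conv_lhs => rw [← DirectSum.decompose_of_mem_same 𝒜 (show p ∈ 𝒜 D from hp), hch]
      simp only [DirectSum.decompose_add, DirectSum.decompose_sum, DirectSum.add_apply,
        DirectSum.sum_apply, Submodule.coe_add, Submodule.coe_sum]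
    rw [h1]
    refine Submodule.add_mem _ (Submodule.sum_mem _ fun j _ => ?_)
      (Submodule.sum_mem _ fun i _ => ?_)
    · have hm : MvPolynomial.monomial (e j) (c j) ∈ 𝒜 (Finsupp.weight v (e j)) :=
        MvPolynomial.isWeightedHomogeneous_monomial _ _ _ rfl
      by_cases hj : Finsupp.weight v (e j) = D
      · rw [← hj, DirectSum.decompose_of_mem_same 𝒜 hm]
        have : MvPolynomial.monomial (e j) (c j) = c j • basisProduct g e (j, 0) := by
          simp [basisProduct, MvPolynomial.smul_monomial]
        rw [this]
        refine Submodule.smul_mem _ _ (Submodule.subset_span ⟨_, ?_, rfl⟩)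
        simp [mem_simplexPoints hu]
      · rw [DirectSum.decompose_of_mem_ne 𝒜 hm hj]
        exact Submodule.zero_mem _
    · by_cases hi : u i ≤ D
      · rw [DirectSum.coe_decompose_mul_of_left_mem_of_le 𝒜 (hg i) hi]
        refine mul_mem_boundedSpan hu i hi (ih _ (by have := hu i; omega) ?_)
        exact SetLike.coe_mem (DirectSum.decompose 𝒜 (h i) (D - u i))
      · rw [DirectSum.coe_decompose_mul_of_left_mem_of_not_le 𝒜 (hg i) hi]
        exact Submodule.zero_mem _

theorem card_simplexPoints_le_mul (hu : ∀ i, 0 < u i) {v : Fin n → ℕ} (hv : ∀ i, 0 < v i)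
    (hg : ∀ i, (g i).IsWeightedHomogeneous v (u i))
    (he : ∀ p : MvPolynomial (Fin n) ℂ, ∃ (c : Fin K → ℂ) (h : Fin n → MvPolynomial (Fin n) ℂ),
      p = ∑ j, MvPolynomial.monomial (e j) (c j) + ∑ i, g i * h i) (D : ℕ) :
    (simplexPoints v D).card ≤ K * (simplexPoints u D).card := by
  classical
  let b : simplexPoints v D → MvPolynomial (Fin n) ℂ := fun α =>
    MvPolynomial.monomial (Finsupp.equivFunOnFinite.symm α.1) 1
  have hb : LinearIndependent ℂ b := by
    have h := (MvPolynomial.basisMonomials (Fin n) ℂ).linearIndependent.comp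
      (fun α : simplexPoints v D => Finsupp.equivFunOnFinite.symm α.1)
      (Finsupp.equivFunOnFinite.symm.injective.comp Subtype.val_injective)
    rwa [MvPolynomial.coe_basisMonomials] at h
  obtain ⟨T, hTdef⟩ : ∃ T, T =
    ((Finset.univ : Finset (Fin K)) ×ˢ simplexPoints u D).image (basisProduct g e) := ⟨_, rfl⟩
  have hT : Set.range b ≤ Submodule.span ℂ (T : Set (MvPolynomial (Fin n) ℂ)) := by
    rintro _ ⟨α, rfl⟩
    have hα := (mem_simplexPoints hv).1 α.2
    rw [hTdef, Finset.coe_image]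
    refine boundedSpan_mono hu hα (mem_boundedSpan hu hg he _ ?_)
    refine MvPolynomial.isWeightedHomogeneous_monomial v _ (1 : ℂ) ?_
    rw [Finsupp.weight_apply, Finsupp.sum_fintype _ _ (by simp)]
    simp
  have h2 : (simplexPoints v D).card ≤ T.card := by
    have h := hb.card_le_card_of_range_subset_span hT
    rwa [Fintype.card_coe] at h
  rw [hTdef] at h2
  refine h2.trans (Finset.card_image_le.trans ?_)
  simp [Finset.card_product]

end Spanning

/-- If quasihomogeneous polynomials `g i` of degrees `u i` generate an ideal of finite codimension,
then the codimension is at least `∏ u i / v i`. -/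
theorem prod_le_finrank_mul_prod {n : ℕ} {u v : Fin n → ℕ} (hu : ∀ i, 0 < u i) (hv : ∀ i, 0 < v i)
    {g : Fin n → MvPolynomial (Fin n) ℂ} (hg : ∀ i, (g i).IsWeightedHomogeneous v (u i))
    [Module.Finite ℂ (MvPolynomial (Fin n) ℂ ⧸ Ideal.span (Set.range g))] :
    ∏ i, u i ≤ Module.finrank ℂ (MvPolynomial (Fin n) ℂ ⧸ Ideal.span (Set.range g)) *
      ∏ i, v i := by
  set I := Ideal.span (Set.range g) with hI
  set s : Set (MvPolynomial (Fin n) ℂ ⧸ I) := Set.range fun α : Fin n →₀ ℕ =>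
    Ideal.Quotient.mk I (MvPolynomial.monomial α 1) with hs
  have hspan : Submodule.span ℂ s = ⊤ := span_range_mk_monomial I
  -- The monomials span the quotient, so a basis can be selected among them; this keeps the
  -- representatives homogeneous.
  obtain ⟨b, hb, hbs, -⟩ := Submodule.exists_fun_fin_finrank_span_eq ℂ s
  choose e he using hb
  have hfr : Module.finrank ℂ (Submodule.span ℂ s) =
      Module.finrank ℂ (MvPolynomial (Fin n) ℂ ⧸ I) := by rw [hspan, finrank_top]
  rw [← hfr]
  refine prod_le_mul_prod_of_card_simplexPoints_le hu hv
    (card_simplexPoints_le_mul (e := e) hu hv hg fun p => ?_)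
  have hp : Ideal.Quotient.mk I p ∈ Submodule.span ℂ (Set.range b) := by
    rw [hbs, hspan]; trivial
  obtain ⟨c, hc⟩ := (Submodule.mem_span_range_iff_exists_fun ℂ).1 hp
  have hmem : p - ∑ j, MvPolynomial.monomial (e j) (c j) ∈ I := by
    rw [← Ideal.Quotient.eq, ← hc, map_sum]
    refine Finset.sum_congr rfl fun j _ => ?_
    have : MvPolynomial.monomial (e j) (c j) = c j • MvPolynomial.monomial (e j) (1 : ℂ) := by
      rw [MvPolynomial.smul_monomial, smul_eq_mul, mul_one]
    rw [this, ← he j]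
    rfl
  obtain ⟨h, hh⟩ := Ideal.mem_span_range_iff_exists_fun.1 hmem
  refine ⟨c, h, ?_⟩
  rw [← sub_eq_iff_eq_add', ← hh]
  exact Finset.sum_congr rfl fun i _ => mul_comm _ _

theorem prod_sub_le_milnorNumber_mul_prod {n : ℕ} {f : MvPolynomial (Fin n) ℂ} {v : Fin n → ℕ}
    {d : ℕ} (hv : ∀ i, 0 < v i) (hvd : ∀ i, v i < d) (hf : f.IsWeightedHomogeneous v d)
    (hsing : HasIsolatedSingularityAtZero f) :
    ∏ i, (d - v i) ≤ milnorNumber f * ∏ i, v i := by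
  obtain ⟨N, hN⟩ := exists_pow_idealOfVars_le_span_pderiv hsing
  have := finite_quotient_of_pow_idealOfVars_le hN
  rw [milnorNumber, jacobianIdeal_eq_map, finrank_quotient_map_polynomialGermHom hN]
  exact prod_le_finrank_mul_prod (fun i => by have := hvd i; omega) hv fun i =>
    hf.pderiv (Nat.sub_add_cancel (hvd i).le)

/-! ### Relations among the weights and their graph -/

/-- On the `i`-th coordinate axis some partial derivative of `f` does not vanish. -/
theorem exists_mul_add_eq_of_isolatedSingularity {n : ℕ} {f : MvPolynomial (Fin n) ℂ}
    {v : Fin n → ℕ} {d : ℕ} (hf : f.IsWeightedHomogeneous v d)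
    (hsing : HasIsolatedSingularityAtZero f) (i : Fin n) : ∃ k a, a * v i + v k = d := by
  classical
  by_contra! hne
  have hx : (Pi.single i 1 : Fin n → ℂ) = 0 := by
    refine (hsing _).1 fun k => ?_
    rw [MvPolynomial.eval_eq']
    refine Finset.sum_eq_zero fun α hα => ?_
    -- At the `i`-th unit vector only pure powers of `x_i` survive. A term `x_i ^ a` of the `k`-th
    -- partial comes from `x_i ^ a * x_k` in `f`, which would give `a * v i + v k = d`.
    by_cases h : ∀ j, j ≠ i → α j = 0
    · exfalso
      have hα' : α = Finsupp.single i (α i) := by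
        ext j
        by_cases hj : j = i
        · subst hj; simp
        · rw [h j hj, Finsupp.single_eq_of_ne hj]
      rw [MvPolynomial.mem_support_iff, MvPolynomial.coeff_pderiv] at hα
      have := hf (left_ne_zero_of_mul hα)
      rw [map_add, Finsupp.weight_single, hα', Finsupp.weight_single] at this
      exact hne k (α i) (by simpa using this)
    · push Not at h
      obtain ⟨j, hj, hj0⟩ := h
      rw [Finset.prod_eq_zero (Finset.mem_univ j), mul_zero]
      simp [hj, hj0]
  simpa using congrFun hx i


/-- A system of weights `w i ∈ (0, 1/2]` with relations `a i * w i + w (κ i) = 1`. -/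
structure WeightGraph (ι : Type*) where
  w : ι → ℚ
  κ : ι → ι
  a : ι → ℕ
  pos : ∀ i, 0 < w i
  le_half : ∀ i, w i ≤ 1 / 2
  rel : ∀ i, a i * w i + w (κ i) = 1
  fixed : ∀ i, w i = 1 / 2 → κ i = i

namespace WeightGraph

variable {ι : Type*} (G : WeightGraph ι)

theorem one_le_a (i : ι) : 1 ≤ G.a i := by
  by_contra! h
  have h0 : G.a i = 0 := by omega
  have h1 := G.rel i
  have h2 := G.le_half (G.κ i)
  rw [h0] at h1
  norm_num at h1
  linarith

/-- Here `w i` and `w (κ i)` are both `1 / 2`, so `fixed` applies. This rules out longer cycles with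
all `a = 1`, whose modulus could be `0`. -/
theorem κ_eq_of_a_eq_one {i : ι} (h : G.a i = 1) : G.κ i = i := by
  have h1 := G.rel i
  rw [h] at h1
  have h2 := G.le_half (G.κ i)
  have h3 := G.le_half i
  push_cast at h1
  exact G.fixed i (by linarith)

/-- In this form the factors `1 - w` telescope along `κ`. -/
theorem odds_eq (i : ι) : (1 - G.w i) / G.w i = G.a i * (1 - G.w i) / (1 - G.w (G.κ i)) := by
  have h1 := G.rel i
  have h2 := G.pos i
  have h3 := G.le_half (G.κ i)
  have h4 : 1 - G.w (G.κ i) = G.a i * G.w i := by linarith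
  have h5 := G.one_le_a i
  have h6 : (G.a i : ℚ) ≠ 0 := by positivity
  rw [h4, mul_div_mul_left _ _ h6]

theorem exists_int_iterate (G : WeightGraph ι) (x : ι) (m : ℕ) : ∃ z : ℤ, G.w (G.κ^[m] x) =
    z + (-1) ^ m * (∏ t ∈ Finset.range m, G.a (G.κ^[t] x) : ℕ) * G.w x := by
  induction m with
  | zero => exact ⟨0, by simp⟩
  | succ m ih =>
    obtain ⟨z, hz⟩ := ih
    refine ⟨1 - G.a (G.κ^[m] x) * z, ?_⟩
    have h := G.rel (G.κ^[m] x)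
    rw [Function.iterate_succ_apply', Finset.prod_range_succ]
    push_cast at hz ⊢
    rw [hz] at h
    linear_combination h

/-- Data on a `κ`-closed set `J` of indices bounding `∏ (1 - w j) / w j` from below. Every index in
`J` is an inner one (in `inner`) or belongs to one of the classes `T u`, which stand for sources or
for cycles that are whole components of the graph. -/
structure Cover (J : Finset ι) where
  E : ℕ
  U : Finset ι
  b : ι → ℕ
  β : ι → ℚ
  T : ι → Set ι
  inner : Set ι
  E_pos : 0 < E
  closed : ∀ j ∈ J, G.κ j ∈ J
  cover : ∀ j ∈ J, j ∈ inner ∨ ∃ u ∈ U, j ∈ T u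
  inner_int : ∀ j ∈ inner, ∃ z : ℤ, E * G.w j = z
  class_int : ∀ u ∈ U, ∀ j ∈ T u, ∃ z : ℤ, E * b u * G.w j = z
  class_le : ∀ u ∈ U, ∀ j ∈ T u, b u * (1 - G.w j) ≤ β u
  two_le : ∀ u ∈ U, 2 ≤ b u
  sub_one_le : ∀ u ∈ U, (b u : ℚ) - 1 ≤ β u
  U_subset : U ⊆ J
  le_prod : E * ∏ u ∈ U, β u ≤ ∏ j ∈ J, (1 - G.w j) / G.w j
  -- Needed for (b) only: without a strict inequality, the cover consists of loops, whose moduli are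
  -- inverses of weights.
  card_lt : U.card < J.card ∨ (inner = ∅ ∧ ∀ u ∈ U, ∃ j, b u * G.w j = 1)

/-- The empty cover. -/
def Cover.empty : G.Cover ∅ where
  E := 1
  U := ∅
  b := 0
  β := 0
  T := fun _ => ∅
  inner := ∅
  E_pos := one_pos
  closed := by simp
  cover := by simp
  inner_int := by simp
  class_int := by simp
  class_le := by simp
  two_le := by simp
  sub_one_le := by simp
  U_subset := by simp
  le_prod := by simp
  card_lt := by simp

variable {G} [DecidableEq ι] {J : Finset ι}

/-- The new index `i` becomes a class with modulus `a i`, because `a i * w i = 1 - w (κ i)`. If `κ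
i` is not inner, its class `T t` becomes inner: `E` absorbs `b t`, the label `t` is reused for `i`,
and `class_le` pays for the old modulus by cancelling `1 - w (κ i)`. -/
theorem Cover.exists_insert (C : G.Cover J) {i : ι} (hi : i ∉ J) (hκ : G.κ i ∈ J) :
    Nonempty (G.Cover (insert i J)) := by
  have hne : G.κ i ≠ i := fun h => hi (h ▸ hκ)
  have ha : 2 ≤ G.a i := by
    have h1 := G.one_le_a i
    have h2 : G.a i ≠ 1 := fun h => hne (G.κ_eq_of_a_eq_one h)
    omega
  have hrel := G.rel i
  have hpos := G.pos i
  have hk := G.le_half (G.κ i)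
  have hkpos := G.pos (G.κ i)
  have hi2 := G.le_half i
  have hiU : i ∉ C.U := fun h => hi (C.U_subset h)
  have hclosed : ∀ j ∈ insert i J, G.κ j ∈ insert i J := by
    intro j hj
    rcases Finset.mem_insert.1 hj with rfl | hj
    · exact Finset.mem_insert_of_mem hκ
    · exact Finset.mem_insert_of_mem (C.closed j hj)
  have hcard : (insert i J).card = J.card + 1 := Finset.card_insert_of_notMem hi
  have hCU := Finset.card_le_card C.U_subset
  have hsub : (G.a i : ℚ) - 1 ≤ G.a i * (1 - G.w i) := by
    linarith
  have hβ : ∀ u ∈ C.U, 0 ≤ C.β u := fun u hu => by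
    have h1 := C.sub_one_le u hu
    have h2 : (2 : ℚ) ≤ C.b u := by exact_mod_cast C.two_le u hu
    linarith
  have hle := C.le_prod
  have hfac : (0 : ℚ) ≤ G.a i * (1 - G.w i) / (1 - G.w (G.κ i)) := by
    apply div_nonneg
    · apply mul_nonneg (Nat.cast_nonneg _); linarith
    · linarith
  have hk1 : (0 : ℚ) < 1 - G.w (G.κ i) := by linarith
  have hai : (0 : ℚ) ≤ G.a i * (1 - G.w i) := mul_nonneg (Nat.cast_nonneg _) (by linarith)
  by_cases hin : G.κ i ∈ C.inner
  · refine ⟨{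
      E := C.E, U := insert i C.U, b := Function.update C.b i (G.a i),
      β := Function.update C.β i (G.a i * (1 - G.w i)), T := Function.update C.T i {i},
      inner := C.inner, E_pos := C.E_pos, closed := hclosed, inner_int := C.inner_int,
      cover := ?_, class_int := ?_, class_le := ?_, two_le := ?_, sub_one_le := ?_,
      U_subset := ?_, le_prod := ?_, card_lt := ?_ }⟩
    · intro j hj
      rcases Finset.mem_insert.1 hj with rfl | hj
      · exact Or.inr ⟨j, Finset.mem_insert_self _ _, by simp⟩
      · refine (C.cover j hj).imp_right ?_
        rintro ⟨u, hu, hju⟩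
        refine ⟨u, Finset.mem_insert_of_mem hu, ?_⟩
        rwa [Function.update_of_ne (by rintro rfl; exact hiU hu)]
    · intro u hu j hj
      rcases Finset.mem_insert.1 hu with rfl | hu'
      · simp only [Function.update_self, Set.mem_singleton_iff] at hj ⊢
        subst hj
        obtain ⟨z, hz⟩ := C.inner_int _ hin
        refine ⟨C.E - z, ?_⟩
        push_cast
        rw [← hz]
        linear_combination (C.E : ℚ) * hrel
      · have hui : u ≠ i := fun h => hiU (h ▸ hu')
        rw [Function.update_of_ne hui] at hj ⊢
        exact C.class_int u hu' j hj
    · intro u hu j hj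
      rcases Finset.mem_insert.1 hu with rfl | hu'
      · simp only [Function.update_self, Set.mem_singleton_iff] at hj ⊢
        rw [hj]
      · have hui : u ≠ i := fun h => hiU (h ▸ hu')
        rw [Function.update_of_ne hui] at hj ⊢
        rw [Function.update_of_ne hui]
        exact C.class_le u hu' j hj
    · intro u hu
      rcases Finset.mem_insert.1 hu with rfl | hu'
      · simpa using ha
      · have hui : u ≠ i := fun h => hiU (h ▸ hu')
        rw [Function.update_of_ne hui]
        exact C.two_le u hu'
    · intro u hu
      rcases Finset.mem_insert.1 hu with rfl | hu'
      · simpa using hsub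
      · have hui : u ≠ i := fun h => hiU (h ▸ hu')
        rw [Function.update_of_ne hui, Function.update_of_ne hui]
        exact C.sub_one_le u hu'
    · exact Finset.insert_subset_insert _ C.U_subset
    · rw [Finset.prod_insert hiU, Finset.prod_insert hi, Function.update_self]
      have e : ∏ u ∈ C.U, Function.update C.β i (G.a i * (1 - G.w i)) u = ∏ u ∈ C.U, C.β u :=
        Finset.prod_congr rfl fun u hu => by
          rw [Function.update_of_ne (by rintro rfl; exact hiU hu)]
      rw [e, G.odds_eq i]
      calc C.E * (G.a i * (1 - G.w i) * ∏ u ∈ C.U, C.β u)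
          = G.a i * (1 - G.w i) * (C.E * ∏ u ∈ C.U, C.β u) := by ring
        _ ≤ (G.a i * (1 - G.w i) / (1 - G.w (G.κ i))) * (C.E * ∏ u ∈ C.U, C.β u) := by
            refine mul_le_mul_of_nonneg_right ?_
              (mul_nonneg (Nat.cast_nonneg _) (Finset.prod_nonneg hβ))
            rw [le_div_iff₀ hk1]
            nlinarith
        _ ≤ _ := mul_le_mul_of_nonneg_left hle hfac
    · left
      rw [Finset.card_insert_of_notMem hiU, hcard]
      rcases C.card_lt with h | ⟨h, -⟩
      · omega
      · rw [h] at hin; exact hin.elim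
  · obtain ⟨t, htU, htT⟩ := (C.cover _ hκ).resolve_left hin
    have hb2 := C.two_le t htU
    refine ⟨{
      E := C.E * C.b t, U := C.U, b := Function.update C.b t (G.a i),
      β := Function.update C.β t (G.a i * (1 - G.w i)), T := Function.update C.T t {i},
      inner := C.inner ∪ C.T t, E_pos := Nat.mul_pos C.E_pos (by omega), closed := hclosed,
      cover := ?_, inner_int := ?_, class_int := ?_, class_le := ?_, two_le := ?_,
      sub_one_le := ?_, U_subset := ?_, le_prod := ?_, card_lt := ?_ }⟩
    · intro j hj
      rcases Finset.mem_insert.1 hj with rfl | hj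
      · exact Or.inr ⟨t, htU, by simp⟩
      · rcases C.cover j hj with h | ⟨u, hu, hju⟩
        · exact Or.inl (Or.inl h)
        · by_cases hut : u = t
          · subst hut; exact Or.inl (Or.inr hju)
          · exact Or.inr ⟨u, hu, by rwa [Function.update_of_ne hut]⟩
    · intro j hj
      push_cast
      rcases hj with hj | hj
      · obtain ⟨z, hz⟩ := C.inner_int j hj
        exact ⟨z * C.b t, by push_cast; rw [← hz]; ring⟩
      · exact C.class_int t htU j hj
    · intro u hu j hj
      by_cases hut : u = t
      · subst hut
        simp only [Function.update_self, Set.mem_singleton_iff] at hj ⊢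
        subst hj
        obtain ⟨z, hz⟩ := C.class_int _ hu _ htT
        refine ⟨C.E * C.b u - z, ?_⟩
        push_cast
        rw [← hz]
        linear_combination (C.E * C.b u : ℚ) * hrel
      · rw [Function.update_of_ne hut] at hj ⊢
        obtain ⟨z, hz⟩ := C.class_int u hu j hj
        exact ⟨z * C.b t, by push_cast; rw [← hz]; ring⟩
    · intro u hu j hj
      by_cases hut : u = t
      · subst hut
        simp only [Function.update_self, Set.mem_singleton_iff] at hj ⊢
        rw [hj]
      · rw [Function.update_of_ne hut] at hj ⊢
        rw [Function.update_of_ne hut]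
        exact C.class_le u hu j hj
    · intro u hu
      by_cases hut : u = t
      · subst hut; simpa using ha
      · rw [Function.update_of_ne hut]
        exact C.two_le u hu
    · intro u hu
      by_cases hut : u = t
      · subst hut; simpa using hsub
      · rw [Function.update_of_ne hut, Function.update_of_ne hut]
        exact C.sub_one_le u hu
    · exact C.U_subset.trans (Finset.subset_insert _ _)
    · rw [Finset.prod_insert hi, G.odds_eq i]
      rw [← Finset.mul_prod_erase _ _ htU] at hle ⊢
      rw [Function.update_self]
      have e : ∏ u ∈ C.U.erase t, Function.update C.β t (G.a i * (1 - G.w i)) u =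
          ∏ u ∈ C.U.erase t, C.β u :=
        Finset.prod_congr rfl fun u hu => by
          rw [Function.update_of_ne (Finset.ne_of_mem_erase hu)]
      rw [e]
      set Q := ∏ u ∈ C.U.erase t, C.β u with hQ
      have hQ0 : 0 ≤ Q := Finset.prod_nonneg fun u hu => hβ u (Finset.mem_of_mem_erase hu)
      have hcl := C.class_le t htU _ htT
      refine le_trans ?_ (mul_le_mul_of_nonneg_left hle hfac)
      rw [div_mul_eq_mul_div, le_div_iff₀ hk1]
      push_cast
      calc (C.E : ℚ) * C.b t * (G.a i * (1 - G.w i) * Q) * (1 - G.w (G.κ i))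
          = (G.a i * (1 - G.w i)) * (C.E * Q) * (C.b t * (1 - G.w (G.κ i))) := by ring
        _ ≤ (G.a i * (1 - G.w i)) * (C.E * Q) * C.β t :=
            mul_le_mul_of_nonneg_left hcl (mul_nonneg hai (mul_nonneg (Nat.cast_nonneg _) hQ0))
        _ = _ := by ring
    · left; omega

/-- A cycle disjoint from `J` becomes one class. Its factors `(1 - w) / w` telescope to `A`, the
product of the `a`'s, which serves as `β`. -/
theorem Cover.exists_union (C : G.Cover J) {x : ι} (hx : x ∈ Function.periodicPts G.κ)
    (hJ : ∀ m, G.κ^[m] x ∉ J) : ∃ J' : Finset ι, J.card < J'.card ∧ Nonempty (G.Cover J') := by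
  set r := Function.minimalPeriod G.κ x with hr
  have hr0 : 0 < r := Function.minimalPeriod_pos_of_mem_periodicPts hx
  set c := (Finset.range r).image fun m => G.κ^[m] x with hc
  have hinj : Set.InjOn (fun m => G.κ^[m] x) (Finset.range r : Set ℕ) := by
    rw [Finset.coe_range]
    exact Function.iterate_injOn_Iio_minimalPeriod
  have hccard : c.card = r := by
    rw [hc, Finset.card_image_of_injOn hinj, Finset.card_range]
  have hmem : ∀ m, G.κ^[m] x ∈ c := fun m => by
    rw [← Function.iterate_mod_minimalPeriod_eq]
    exact Finset.mem_image_of_mem _ (Finset.mem_range.2 (Nat.mod_lt _ hr0))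
  have hxc : x ∈ c := hmem 0
  have hdisj : Disjoint J c := by
    rw [Finset.disjoint_right]
    intro j hj
    obtain ⟨m, -, rfl⟩ := Finset.mem_image.1 hj
    exact hJ m
  have hxU : x ∉ C.U := fun h => hJ 0 (C.U_subset h)
  set A := ∏ t ∈ Finset.range r, G.a (G.κ^[t] x) with hA
  have hA1 : 1 ≤ A := Finset.one_le_prod' fun t _ => G.one_le_a _
  have hodds : ∏ j ∈ c, (1 - G.w j) / G.w j = A := by
    rw [hc, Finset.prod_image hinj]
    have h1 : ∀ m ∈ Finset.range r, (1 - G.w (G.κ^[m] x)) / G.w (G.κ^[m] x) =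
        (G.a (G.κ^[m] x)) * ((1 - G.w (G.κ^[m] x)) / (1 - G.w (G.κ^[m + 1] x))) := fun m _ => by
      rw [G.odds_eq, Function.iterate_succ_apply', mul_div_assoc]
    rw [Finset.prod_congr rfl h1, Finset.prod_mul_distrib]
    have h2 : ∏ m ∈ Finset.range r, (1 - G.w (G.κ^[m] x)) / (1 - G.w (G.κ^[m + 1] x)) = 1 := by
      have h3 : ∀ m, ∏ t ∈ Finset.range m, (1 - G.w (G.κ^[t] x)) / (1 - G.w (G.κ^[t + 1] x)) =
          (1 - G.w x) / (1 - G.w (G.κ^[m] x)) := by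
        have hne : ∀ j, 1 - G.w j ≠ 0 := fun j => by have := G.le_half j; intro h; linarith
        intro m
        induction m with
        | zero => simp [hne]
        | succ m ih =>
          rw [Finset.prod_range_succ, ih, div_mul_div_cancel₀ (hne _)]
      rw [h3, hr, Function.iterate_minimalPeriod, div_self]
      have := G.le_half x
      intro h; linarith
    rw [h2, mul_one, hA]
    push_cast
    rfl
  -- Once around the cycle, `w x ≡ (-1) ^ r * A * w x` modulo integers, so `A - (-1) ^ r` clears the
  -- denominator.
  obtain ⟨b, hbA, hbx⟩ : ∃ b : ℕ, (b : ℚ) = A - (-1) ^ r ∧ ∃ z : ℤ, b * G.w x = z := by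
    obtain ⟨z, hz⟩ := exists_int_iterate G x r
    rw [hr, Function.iterate_minimalPeriod, ← hr, ← hA] at hz
    rcases Nat.even_or_odd r with h | h
    · rw [h.neg_one_pow] at hz ⊢
      refine ⟨A - 1, by push_cast [hA1]; ring, -z, ?_⟩
      push_cast [hA1]
      linear_combination -hz
    · rw [h.neg_one_pow] at hz ⊢
      exact ⟨A + 1, by push_cast; ring, z, by push_cast; linear_combination hz⟩
  have hsub : (b : ℚ) - 1 ≤ A := by
    rw [hbA]
    rcases neg_one_pow_eq_or ℚ r with h | h <;> rw [h] <;> linarith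
  have hb0 : 0 < b := by
    rw [Nat.pos_iff_ne_zero]
    rintro rfl
    have hA' : A = 1 ∧ r ≠ 1 := by
      rcases Nat.even_or_odd r with h | h
      · rw [h.neg_one_pow] at hbA
        push_cast at hbA
        refine ⟨by exact_mod_cast (by linarith : (A : ℚ) = 1), ?_⟩
        rintro h1
        rw [h1] at h
        exact absurd h (by decide)
      · rw [h.neg_one_pow] at hbA
        have : (0 : ℚ) ≤ A := Nat.cast_nonneg _
        push_cast at hbA
        linarith
    have hdvd : G.a x ∣ A := Finset.dvd_prod_of_mem (fun t => G.a (G.κ^[t] x))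
      (Finset.mem_range.2 hr0)
    rw [hA'.1, Nat.dvd_one] at hdvd
    exact hA'.2 (Function.minimalPeriod_eq_one_iff_isFixedPt.2 (G.κ_eq_of_a_eq_one hdvd))
  have hint : ∀ j ∈ c, ∃ z : ℤ, b * G.w j = z := by
    intro j hj
    obtain ⟨m, -, rfl⟩ := Finset.mem_image.1 hj
    obtain ⟨z, hz⟩ := exists_int_iterate G x m
    obtain ⟨y, hy⟩ := hbx
    refine ⟨b * z + (-1) ^ m * (∏ t ∈ Finset.range m, G.a (G.κ^[t] x) : ℕ) * y, ?_⟩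
    push_cast at hz ⊢
    rw [hz, ← hy]
    ring
  -- A positive integer is at least `1`; hence `b ≥ 2` as `w ≤ 1 / 2`, and `b * (1 - w j) ≤ b - 1 ≤
  -- A`.
  have hone : ∀ j ∈ c, 1 ≤ b * G.w j := by
    intro j hj
    obtain ⟨z, hz⟩ := hint j hj
    have h1 : 0 < b * G.w j := mul_pos (by exact_mod_cast hb0) (G.pos j)
    rw [hz] at h1 ⊢
    exact_mod_cast h1
  have hb2 : 2 ≤ b := by
    have h1 := hone x hxc
    have h2 := G.le_half x
    have h3 : (2 : ℚ) ≤ b := by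
      have : (0 : ℚ) < b := by exact_mod_cast hb0
      nlinarith
    exact_mod_cast h3
  have hUne : ∀ u ∈ C.U, u ≠ x := by rintro u hu rfl; exact hxU hu
  have hCU := Finset.card_le_card C.U_subset
  have hcardu : (J ∪ c).card = J.card + r := by rw [Finset.card_union_of_disjoint hdisj, hccard]
  refine ⟨J ∪ c, by omega, ⟨{
      E := C.E, U := insert x C.U, b := Function.update C.b x b,
      β := Function.update C.β x A, T := Function.update C.T x c, inner := C.inner,
      E_pos := C.E_pos, inner_int := C.inner_int, closed := ?_, cover := ?_,
      class_int := ?_, class_le := ?_, two_le := ?_, sub_one_le := ?_, U_subset := ?_,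
      le_prod := ?_, card_lt := ?_ }⟩⟩
  · intro j hj
    rcases Finset.mem_union.1 hj with hj | hj
    · exact Finset.mem_union_left _ (C.closed j hj)
    · obtain ⟨m, -, rfl⟩ := Finset.mem_image.1 hj
      refine Finset.mem_union_right _ ?_
      have := hmem (m + 1)
      rwa [Function.iterate_succ_apply'] at this
  · intro j hj
    rcases Finset.mem_union.1 hj with hj | hj
    · refine (C.cover j hj).imp_right ?_
      rintro ⟨u, hu, hju⟩
      exact ⟨u, Finset.mem_insert_of_mem hu, by rwa [Function.update_of_ne (hUne u hu)]⟩
    · exact Or.inr ⟨x, Finset.mem_insert_self _ _, by simpa using hj⟩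
  · intro u hu j hj
    rcases Finset.mem_insert.1 hu with rfl | hu
    · simp only [Function.update_self, Finset.mem_coe] at hj ⊢
      obtain ⟨z, hz⟩ := hint j hj
      exact ⟨C.E * z, by push_cast; rw [← hz]; ring⟩
    · rw [Function.update_of_ne (hUne u hu)] at hj ⊢
      exact C.class_int u hu j hj
  · intro u hu j hj
    rcases Finset.mem_insert.1 hu with rfl | hu
    · simp only [Function.update_self, Finset.mem_coe] at hj ⊢
      linarith [hone j hj]
    · rw [Function.update_of_ne (hUne u hu)] at hj ⊢
      rw [Function.update_of_ne (hUne u hu)]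
      exact C.class_le u hu j hj
  · intro u hu
    rcases Finset.mem_insert.1 hu with rfl | hu
    · simpa using hb2
    · rw [Function.update_of_ne (hUne u hu)]
      exact C.two_le u hu
  · intro u hu
    rcases Finset.mem_insert.1 hu with rfl | hu
    · simpa using hsub
    · rw [Function.update_of_ne (hUne u hu), Function.update_of_ne (hUne u hu)]
      exact C.sub_one_le u hu
  · exact Finset.insert_subset (Finset.mem_union_right _ hxc)
      (C.U_subset.trans Finset.subset_union_left)
  · rw [Finset.prod_insert hxU, Finset.prod_union hdisj, hodds, Function.update_self]
    have e : ∏ u ∈ C.U, Function.update C.β x (A : ℚ) u = ∏ u ∈ C.U, C.β u :=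
      Finset.prod_congr rfl fun u hu => by rw [Function.update_of_ne (hUne u hu)]
    rw [e]
    calc (C.E : ℚ) * (A * ∏ u ∈ C.U, C.β u) = (C.E * ∏ u ∈ C.U, C.β u) * A := by ring
      _ ≤ _ := mul_le_mul_of_nonneg_right C.le_prod (Nat.cast_nonneg _)
  · rw [Finset.card_insert_of_notMem hxU, hcardu]
    rcases C.card_lt with h | ⟨h, h'⟩
    · left; omega
    · by_cases hr1 : r = 1
      · refine Or.inr ⟨h, fun u hu => ?_⟩
        rcases Finset.mem_insert.1 hu with rfl | hu
        · refine ⟨u, ?_⟩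
          have hfix : G.κ u = u := Function.minimalPeriod_eq_one_iff_isFixedPt.1 hr1
          have h1 := G.rel u
          rw [hfix] at h1
          have hAa : A = G.a u := by rw [hA, hr1]; simp
          rw [Function.update_self, hbA, hr1, hAa]
          linear_combination h1
        · rw [Function.update_of_ne (hUne u hu)]
          exact h' u hu
      · left; omega

/-- Follow `κ` from an uncovered index. If the orbit enters `J`, insert the last index before entry;
otherwise finiteness yields a cycle disjoint from `J`. -/
theorem exists_cover_univ [Fintype ι] (G : WeightGraph ι) : Nonempty (G.Cover Finset.univ) := by
  have step : ∀ J : Finset ι, Nonempty (G.Cover J) → J ≠ Finset.univ →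
      ∃ J' : Finset ι, J.card < J'.card ∧ Nonempty (G.Cover J') := by
    rintro J ⟨C⟩ hJ
    obtain ⟨i, hi⟩ : ∃ i, i ∉ J := by
      by_contra! h
      exact hJ (Finset.eq_univ_iff_forall.2 h)
    by_cases hex : ∃ m, G.κ^[m] i ∈ J
    · classical
      have hm := Nat.find_spec hex
      have hmin := fun k => Nat.find_min hex (m := k)
      generalize Nat.find hex = m at hm hmin
      cases m with
      | zero => exact (hi hm).elim
      | succ m =>
        have h1 := hmin m (Nat.lt_succ_self m)
        rw [Function.iterate_succ_apply'] at hm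
        exact ⟨_, by rw [Finset.card_insert_of_notMem h1]; omega, C.exists_insert h1 hm⟩
    · push Not at hex
      obtain ⟨p, q, hpq, h⟩ : ∃ p q, p < q ∧ G.κ^[p] i = G.κ^[q] i := by
        obtain ⟨p, q, hne, h⟩ := Finite.exists_ne_map_eq_of_infinite fun m => G.κ^[m] i
        rcases lt_or_gt_of_ne hne with h' | h'
        · exact ⟨p, q, h', h⟩
        · exact ⟨q, p, h', h.symm⟩
      refine C.exists_union (x := G.κ^[p] i) ?_ fun m => ?_
      · refine Function.mk_mem_periodicPts (n := q - p) (by omega) ?_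
        rw [Function.IsPeriodicPt, Function.IsFixedPt, ← Function.iterate_add_apply,
          Nat.sub_add_cancel hpq.le, h]
      · rw [← Function.iterate_add_apply]
        exact hex _
  have hind : ∀ m ≤ (Finset.univ : Finset ι).card, ∃ J : Finset ι, m ≤ J.card ∧
      Nonempty (G.Cover J) := by
    intro m
    induction m with
    | zero => exact fun _ => ⟨∅, le_rfl, ⟨Cover.empty G⟩⟩
    | succ m ih =>
      intro hm
      obtain ⟨J, hJ, hC⟩ := ih (by omega)
      by_cases hu : J = Finset.univ
      · exact ⟨J, by rw [hu]; exact hm, hC⟩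
      · obtain ⟨J', hJ', hC'⟩ := step J hC hu
        exact ⟨J', by omega, hC'⟩
  obtain ⟨J, hJ, hC⟩ := hind _ le_rfl
  rwa [(Finset.card_eq_iff_eq_univ J).1 (le_antisymm (Finset.card_le_univ J) hJ)] at hC

end WeightGraph


/-! ### Least common multiples and products over primes -/

/-- Process the `b u` one by one. If `b u` is coprime to the current lcm, put `u` into `S`.
Otherwise the gcd is at least `2`, so the lcm grows by a factor at most `b u / 2 ≤ b u - 1`. -/
theorem Finset.exists_pairwise_coprime_lcm_le {ι : Type*} [DecidableEq ι] {b : ι → ℕ}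
    (U : Finset ι) (hb : ∀ u ∈ U, 2 ≤ b u) :
    ∃ S ⊆ U, (S : Set ι).Pairwise (fun s t => Nat.Coprime (b s) (b t)) ∧
      ((U.lcm b : ℕ) : ℚ) ≤ (∏ s ∈ S, (b s : ℚ) / ((b s : ℚ) - 1)) * ∏ u ∈ U, ((b u : ℚ) - 1) := by
  induction U using Finset.induction_on with
  | empty => exact ⟨∅, subset_rfl, by simp, by simp⟩
  | insert u U hu ih =>
    obtain ⟨S, hSU, hS, hle⟩ := ih fun x hx => hb x (Finset.mem_insert_of_mem hx)
    have hbu : 2 ≤ b u := hb u (Finset.mem_insert_self _ _)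
    have hbuQ : (2 : ℚ) ≤ b u := by exact_mod_cast hbu
    have huS : u ∉ S := fun h => hu (hSU h)
    rw [Finset.lcm_insert, Finset.prod_insert hu]
    change ∃ S ⊆ insert u U, _ ∧ ((Nat.lcm (b u) (U.lcm b) : ℕ) : ℚ) ≤ _
    by_cases hc : Nat.Coprime (b u) (U.lcm b)
    · refine ⟨insert u S, Finset.insert_subset_insert _ hSU, ?_, ?_⟩
      · rw [Finset.coe_insert, Set.pairwise_insert]
        have hut : ∀ t ∈ S, Nat.Coprime (b u) (b t) := fun t ht =>
          hc.coprime_dvd_right (Finset.dvd_lcm (hSU ht))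
        exact ⟨hS, fun t ht _ => ⟨hut t ht, (hut t ht).symm⟩⟩
      · rw [Finset.prod_insert huS, hc.lcm_eq_mul]
        have h0 : (b u : ℚ) - 1 ≠ 0 := by intro h; linarith
        push_cast
        calc (b u : ℚ) * (U.lcm b : ℕ) ≤ b u * ((∏ s ∈ S, (b s : ℚ) / ((b s : ℚ) - 1)) *
              ∏ u ∈ U, ((b u : ℚ) - 1)) := mul_le_mul_of_nonneg_left hle (by linarith)
          _ = _ := by field_simp
    · refine ⟨S, hSU.trans (Finset.subset_insert _ _), hS, ?_⟩
      have hg : 2 ≤ Nat.gcd (b u) (U.lcm b) := by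
        have h1 : 0 < Nat.gcd (b u) (U.lcm b) := Nat.gcd_pos_of_pos_left _ (by omega)
        have h2 : Nat.gcd (b u) (U.lcm b) ≠ 1 := hc
        omega
      have h2 : 2 * Nat.lcm (b u) (U.lcm b) ≤ b u * U.lcm b := by
        rw [← Nat.gcd_mul_lcm (b u) (U.lcm b)]
        exact Nat.mul_le_mul_right _ hg
      have h2Q : (2 : ℚ) * (Nat.lcm (b u) (U.lcm b) : ℕ) ≤ b u * (U.lcm b : ℕ) := by
        exact_mod_cast h2
      have hL : (0 : ℚ) ≤ (U.lcm b : ℕ) := Nat.cast_nonneg _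
      calc ((Nat.lcm (b u) (U.lcm b) : ℕ) : ℚ) ≤ ((b u : ℚ) - 1) * (U.lcm b : ℕ) := by nlinarith
        _ ≤ ((b u : ℚ) - 1) * ((∏ s ∈ S, (b s : ℚ) / ((b s : ℚ) - 1)) *
              ∏ u ∈ U, ((b u : ℚ) - 1)) := mul_le_mul_of_nonneg_left hle (by linarith)
        _ = _ := by ring

theorem div_sub_one_le_div_sub_one {x y : ℚ} (hx : 1 < x) (hxy : x ≤ y) :
    y / (y - 1) ≤ x / (x - 1) := by
  rw [div_le_div_iff₀ (by linarith) (by linarith)]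
  nlinarith

theorem one_le_div_sub_one {x : ℚ} (hx : 1 < x) : 1 ≤ x / (x - 1) := by
  rw [one_le_div (by linarith)]
  linarith

theorem primeRatioProduct_mono : Monotone primeRatioProduct := by
  refine monotone_nat_of_le_succ fun n => ?_
  unfold primeRatioProduct
  rw [Finset.prod_range_succ]
  have hp : ∀ i, (1 : ℚ) < Nat.nth Nat.Prime i := fun i => by
    exact_mod_cast (Nat.prime_nth_prime i).one_lt
  refine le_mul_of_one_le_right (Finset.prod_nonneg fun i _ => ?_) (one_le_div_sub_one (hp n))
  exact zero_le_one.trans (one_le_div_sub_one (hp i))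

/-- The `k`-th smallest element of `P` is at least the `k`-th prime, and `x / (x - 1)` decreases. -/
theorem prod_primes_le_primeRatioProduct (P : Finset ℕ) (hP : ∀ p ∈ P, p.Prime) :
    ∏ p ∈ P, (p : ℚ) / ((p : ℚ) - 1) ≤ primeRatioProduct P.card := by
  induction P using Finset.induction_on_max with
  | empty => simp [primeRatioProduct]
  | insert q P hq ih =>
    have hqP : q ∉ P := fun h => (hq q h).false
    have hqp := hP q (Finset.mem_insert_self _ _)
    have hpr : ∀ p ∈ P, p.Prime := fun p hp => hP p (Finset.mem_insert_of_mem hp)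
    rw [Finset.prod_insert hqP, Finset.card_insert_of_notMem hqP, mul_comm, primeRatioProduct,
      Finset.prod_range_succ]
    have hnth : Nat.nth Nat.Prime P.card ≤ q := by
      conv_rhs => rw [← Nat.nth_count hqp]
      refine Nat.nth_monotone Nat.infinite_setOfPred_prime ?_
      rw [Nat.count_eq_card_filter_range]
      refine Finset.card_le_card fun p hp => ?_
      exact Finset.mem_filter.2 ⟨Finset.mem_range.2 (hq p hp), hpr p hp⟩
    have h1 : (1 : ℚ) < Nat.nth Nat.Prime P.card := by
      exact_mod_cast (Nat.prime_nth_prime _).one_lt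
    refine mul_le_mul (ih hpr) (div_sub_one_le_div_sub_one h1 (by exact_mod_cast hnth)) ?_ ?_
    · exact zero_le_one.trans (one_le_div_sub_one (by exact_mod_cast hqp.one_lt))
    · refine Finset.prod_nonneg fun i _ => zero_le_one.trans (one_le_div_sub_one ?_)
      exact_mod_cast (Nat.prime_nth_prime i).one_lt

section Coprime

variable {ι : Type*} {b : ι → ℕ} {S : Finset ι}

theorem injOn_minFac_of_pairwise_coprime
    (hS : (S : Set ι).Pairwise fun s t => Nat.Coprime (b s) (b t)) (hb : ∀ s ∈ S, 2 ≤ b s) :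
    Set.InjOn (fun s => (b s).minFac) (S : Set ι) := by
  intro s hs t ht hst
  by_contra hne
  have hc := hS hs ht hne
  have hst : (b s).minFac = (b t).minFac := hst
  have hp : (b s).minFac.Prime := Nat.minFac_prime (by have := hb s hs; omega)
  exact Nat.not_coprime_of_dvd_of_dvd hp.one_lt (Nat.minFac_dvd _)
    (hst ▸ Nat.minFac_dvd (b t)) hc

theorem prod_div_sub_one_le_prod_minFac [DecidableEq ι]
    (hS : (S : Set ι).Pairwise fun s t => Nat.Coprime (b s) (b t)) (hb : ∀ s ∈ S, 2 ≤ b s) :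
    ∏ s ∈ S, (b s : ℚ) / ((b s : ℚ) - 1) ≤
      ∏ p ∈ S.image fun s => (b s).minFac, (p : ℚ) / ((p : ℚ) - 1) := by
  rw [Finset.prod_image (injOn_minFac_of_pairwise_coprime hS hb)]
  refine Finset.prod_le_prod (fun s hs => ?_) fun s hs => ?_
  · have := hb s hs
    exact zero_le_one.trans (one_le_div_sub_one (by exact_mod_cast (by omega : 1 < b s)))
  · have := hb s hs
    refine div_sub_one_le_div_sub_one ?_ (by exact_mod_cast Nat.minFac_le (by omega))
    exact_mod_cast (Nat.minFac_prime (by omega)).one_lt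

theorem prod_div_sub_one_le_primeRatioProduct
    (hS : (S : Set ι).Pairwise fun s t => Nat.Coprime (b s) (b t)) (hb : ∀ s ∈ S, 2 ≤ b s) :
    ∏ s ∈ S, (b s : ℚ) / ((b s : ℚ) - 1) ≤ primeRatioProduct S.card := by
  classical
  refine (prod_div_sub_one_le_prod_minFac hS hb).trans ?_
  have h := prod_primes_le_primeRatioProduct (S.image fun s => (b s).minFac) ?_
  · rwa [Finset.card_image_of_injOn (injOn_minFac_of_pairwise_coprime hS hb)] at h
  · intro p hp
    obtain ⟨s, hs, rfl⟩ := Finset.mem_image.1 hp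
    exact Nat.minFac_prime (by have := hb s hs; omega)

theorem div_sub_one_mul_div_sub_one_le_two {x y : ℕ} (hx : 3 ≤ x) (hy : 3 ≤ y) (hxy : x ≠ y) :
    (x : ℚ) / ((x : ℚ) - 1) * ((y : ℚ) / ((y : ℚ) - 1)) ≤ 2 := by
  wlog h : x < y generalizing x y
  · rw [mul_comm]
    exact this hy hx hxy.symm (by omega)
  have h3 : (x : ℚ) / ((x : ℚ) - 1) ≤ 3 / (3 - 1) :=
    div_sub_one_le_div_sub_one (by norm_num) (by exact_mod_cast hx)
  have h4 : (y : ℚ) / ((y : ℚ) - 1) ≤ 4 / (4 - 1) :=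
    div_sub_one_le_div_sub_one (by norm_num) (by exact_mod_cast (by omega : 4 ≤ y))
  have h0 : (1 : ℚ) ≤ (y : ℚ) / ((y : ℚ) - 1) :=
    one_le_div_sub_one (by exact_mod_cast (by omega : 1 < y))
  calc _ ≤ (3 / (3 - 1) : ℚ) * (4 / (4 - 1)) := mul_le_mul h3 h4 (by linarith) (by norm_num)
    _ = 2 := by norm_num

/-- Pairwise coprime numbers without the number `2` allow for one factor less. -/
theorem prod_div_sub_one_le_primeRatioProduct_sub_one
    (hS : (S : Set ι).Pairwise fun s t => Nat.Coprime (b s) (b t)) (hb : ∀ s ∈ S, 3 ≤ b s)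
    (hcard : 2 ≤ S.card) :
    ∏ s ∈ S, (b s : ℚ) / ((b s : ℚ) - 1) ≤ primeRatioProduct (S.card - 1) := by
  classical
  -- By coprimality at most one `b s` is even. It and one further `b t` are distinct and at least
  -- `3`, so together they contribute at most `3/2 * 4/3 = 2`, the factor of the prime `2`. The
  -- others have distinct odd minimal prime factors.
  obtain ⟨s, hs, hodd⟩ : ∃ s ∈ S, ∀ t ∈ S, t ≠ s → ¬ 2 ∣ b t := by
    by_cases h : ∃ s ∈ S, 2 ∣ b s
    · obtain ⟨s, hs, h2⟩ := h
      exact ⟨s, hs, fun t ht hts h2t =>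
        Nat.not_coprime_of_dvd_of_dvd one_lt_two h2t h2 (hS ht hs hts)⟩
    · push Not at h
      obtain ⟨s, hs⟩ := Finset.card_pos.1 (by omega : 0 < S.card)
      exact ⟨s, hs, fun t ht _ => h t ht⟩
  obtain ⟨t, ht⟩ : (S.erase s).Nonempty := by
    rw [← Finset.card_pos, Finset.card_erase_of_mem hs]; omega
  have hts := Finset.ne_of_mem_erase ht
  have htS := Finset.mem_of_mem_erase ht
  have hne : b s ≠ b t := fun h => by
    have h1 : Nat.Coprime (b s) (b t) := hS hs htS hts.symm
    rw [h, Nat.coprime_self] at h1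
    have := hb t htS
    omega
  set R := (S.erase s).erase t with hR
  have hRS : R ⊆ S := (Finset.erase_subset _ _).trans (Finset.erase_subset _ _)
  have hRc : (R : Set ι).Pairwise fun s t => Nat.Coprime (b s) (b t) := hS.mono hRS
  have hRb : ∀ r ∈ R, 2 ≤ b r := fun r hr => by have := hb r (hRS hr); omega
  set P := R.image fun s => (b s).minFac with hP
  have h2P : 2 ∉ P := by
    intro h
    obtain ⟨r, hr, hr2⟩ := Finset.mem_image.1 h
    refine hodd r (hRS hr) (Finset.ne_of_mem_erase (Finset.mem_of_mem_erase hr)) ?_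
    rw [← hr2]
    exact Nat.minFac_dvd _
  have hPcard : (insert 2 P).card = S.card - 1 := by
    rw [Finset.card_insert_of_notMem h2P, hP,
      Finset.card_image_of_injOn (injOn_minFac_of_pairwise_coprime hRc hRb), hR,
      Finset.card_erase_of_mem ht, Finset.card_erase_of_mem hs]
    omega
  have hprime : ∀ p ∈ insert 2 P, p.Prime := by
    intro p hp
    rcases Finset.mem_insert.1 hp with rfl | hp
    · exact Nat.prime_two
    · obtain ⟨r, hr, rfl⟩ := Finset.mem_image.1 hp
      exact Nat.minFac_prime (by have := hRb r hr; omega)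
  rw [← hPcard, ← Finset.mul_prod_erase _ _ hs, ← Finset.mul_prod_erase _ _ ht, ← mul_assoc]
  refine le_trans ?_ (prod_primes_le_primeRatioProduct _ hprime)
  rw [Finset.prod_insert h2P]
  refine mul_le_mul ?_ (prod_div_sub_one_le_prod_minFac hRc hRb)
    (Finset.prod_nonneg fun r hr => ?_) (by norm_num)
  · refine (div_sub_one_mul_div_sub_one_le_two (hb s hs) (hb t htS) hne).trans ?_
    norm_num
  · have := hRb r hr
    exact zero_le_one.trans (one_le_div_sub_one (by exact_mod_cast (by omega : 1 < b r)))

end Coprime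

/-! ### From covers to the bound on `d` -/

/-- The common denominator of a weight system whose indices are all related to some index by
`a i * v i + v (κ i) = d` is bounded in terms of `∏ (d - v i) / v i`. -/
theorem le_primeRatioProduct_mul_prod {n d : ℕ} {v : Fin n → ℕ} (hv : ∀ i, 0 < v i) (hd : 0 < d)
    (hred : Nat.gcd (Finset.univ.gcd v) d = 1) (hhalf : ∀ i, 2 * v i ≤ d)
    (hrel : ∀ i, ∃ k a, a * v i + v k = d) :
    (d : ℚ) ≤ primeRatioProduct n * ∏ i, ((d : ℚ) - v i) / v i ∧
    (2 ≤ n → (∀ i, 2 * v i < d) →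
      (d : ℚ) ≤ primeRatioProduct (n - 1) * ∏ i, ((d : ℚ) - v i) / v i) := by
  -- For weight `1 / 2` the loop with `a = 1` is chosen, as `fixed` demands.
  have hrel' : ∀ i, ∃ k a, a * v i + v k = d ∧ (2 * v i = d → k = i) := by
    intro i
    by_cases h : 2 * v i = d
    · exact ⟨i, 1, by omega, fun _ => rfl⟩
    · obtain ⟨k, a, hka⟩ := hrel i
      exact ⟨k, a, hka, fun h' => (h h').elim⟩
  choose κ a hκ hκ2 using hrel'
  have hdQ : (0 : ℚ) < d := by exact_mod_cast hd
  let G : WeightGraph (Fin n) :=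
    { w := fun i => v i / d
      κ := κ
      a := a
      pos := fun i => div_pos (by exact_mod_cast hv i) hdQ
      le_half := fun i => by
        rw [div_le_div_iff₀ hdQ two_pos]
        have := hhalf i
        exact_mod_cast (by omega : v i * 2 ≤ 1 * d)
      rel := fun i => by
        rw [← mul_div_assoc, ← add_div, div_eq_one_iff_eq hdQ.ne']
        exact_mod_cast hκ i
      fixed := fun i hi => by
        rw [div_eq_div_iff hdQ.ne' two_ne_zero] at hi
        exact hκ2 i (by
          have : v i * 2 = 1 * d := by exact_mod_cast hi
          omega) }
  obtain ⟨C⟩ := WeightGraph.exists_cover_univ G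
  have hw : ∀ i, G.w i = v i / d := fun i => rfl
  have hMeq : ∏ j, (1 - G.w j) / G.w j = ∏ i, ((d : ℚ) - v i) / v i := by
    refine Finset.prod_congr rfl fun i _ => ?_
    have : (v i : ℚ) ≠ 0 := by exact_mod_cast (hv i).ne'
    rw [hw]
    field_simp
  have hdvd : d ∣ C.E * C.U.lcm C.b := by
    have h1 : ∀ k, d ∣ (C.E * C.U.lcm C.b) * v k := by
      intro k
      have key : ∃ z : ℤ, ((C.E * C.U.lcm C.b : ℕ) : ℚ) * G.w k = z := by
        rcases C.cover k (Finset.mem_univ k) with h | ⟨u, hu, h⟩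
        · obtain ⟨z, hz⟩ := C.inner_int k h
          exact ⟨z * C.U.lcm C.b, by push_cast; rw [← hz]; ring⟩
        · obtain ⟨z, hz⟩ := C.class_int u hu k h
          obtain ⟨c, hc⟩ : C.b u ∣ C.U.lcm C.b := Finset.dvd_lcm hu
          exact ⟨z * c, by rw [hc]; push_cast; rw [← hz]; ring⟩
      obtain ⟨z, hz⟩ := key
      rw [hw, ← mul_div_assoc, div_eq_iff hdQ.ne'] at hz
      have hz' : (((C.E * C.U.lcm C.b) * v k : ℕ) : ℤ) = z * d := by exact_mod_cast hz
      exact Int.natCast_dvd_natCast.1 ⟨z, by rw [hz', mul_comm]⟩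
    have h2 : d ∣ (C.E * C.U.lcm C.b) * Finset.univ.gcd v := by
      have h3 := Finset.dvd_gcd (s := Finset.univ) (f := fun k => (C.E * C.U.lcm C.b) * v k)
        fun k _ => h1 k
      rwa [Finset.gcd_mul_left, normalize_eq] at h3
    exact Nat.Coprime.dvd_of_dvd_mul_right (Nat.Coprime.symm hred) h2
  have hlcm0 : C.U.lcm C.b ≠ 0 := by
    rw [Ne, Finset.lcm_eq_zero_iff]
    rintro ⟨u, hu, h⟩
    have := C.two_le u hu
    omega
  have hdle : (d : ℚ) ≤ C.E * (C.U.lcm C.b : ℕ) := by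
    exact_mod_cast Nat.le_of_dvd (Nat.mul_pos C.E_pos (Nat.pos_of_ne_zero hlcm0)) hdvd
  obtain ⟨S, hSU, hS, hSle⟩ := C.U.exists_pairwise_coprime_lcm_le C.two_le
  have hb2 : ∀ s ∈ S, 2 ≤ C.b s := fun s hs => C.two_le s (hSU hs)
  set Q := ∏ s ∈ S, (C.b s : ℚ) / ((C.b s : ℚ) - 1) with hQ
  have hb1 : ∀ u ∈ C.U, (1 : ℚ) < C.b u := fun u hu => by
    have := C.two_le u hu
    exact_mod_cast (by omega : 1 < C.b u)
  have hQ0 : 0 ≤ Q := Finset.prod_nonneg fun s hs =>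
    zero_le_one.trans (one_le_div_sub_one (hb1 s (hSU hs)))
  set M := ∏ i, ((d : ℚ) - v i) / v i with hM
  have hEM : C.E * ∏ u ∈ C.U, ((C.b u : ℚ) - 1) ≤ M := by
    rw [← hMeq]
    refine le_trans (mul_le_mul_of_nonneg_left ?_ (Nat.cast_nonneg _)) C.le_prod
    exact Finset.prod_le_prod (fun u hu => by have := hb1 u hu; linarith) C.sub_one_le
  have hM0 : 0 ≤ M := le_trans (mul_nonneg (Nat.cast_nonneg _)
    (Finset.prod_nonneg fun u hu => by have := hb1 u hu; linarith)) hEM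
  have hdQM : (d : ℚ) ≤ Q * M := by
    calc (d : ℚ) ≤ C.E * (Q * ∏ u ∈ C.U, ((C.b u : ℚ) - 1)) :=
          hdle.trans (mul_le_mul_of_nonneg_left hSle (Nat.cast_nonneg _))
      _ = Q * (C.E * ∏ u ∈ C.U, ((C.b u : ℚ) - 1)) := by ring
      _ ≤ Q * M := mul_le_mul_of_nonneg_left hEM hQ0
  have hSU' := Finset.card_le_card hSU
  have hUn : C.U.card ≤ n := (Finset.card_le_univ _).trans (by simp)
  have hQS : Q ≤ primeRatioProduct S.card := prod_div_sub_one_le_primeRatioProduct hS hb2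
  refine ⟨hdQM.trans (mul_le_mul_of_nonneg_right ?_ hM0), fun hn hlt =>
    hdQM.trans (mul_le_mul_of_nonneg_right ?_ hM0)⟩
  · exact hQS.trans (primeRatioProduct_mono (by omega))
  · by_cases hcard : S.card < n
    · exact hQS.trans (primeRatioProduct_mono (by omega))
    -- All `n` indices carry coprime moduli, so `card_lt` gives `b s * v j = d` for some `j`, and `2
    -- * v j < d` forces `b s ≥ 3`.
    · have hSn : S.card = n := by omega
      obtain ⟨-, hb⟩ := C.card_lt.resolve_left (by
        rw [Finset.card_univ, Fintype.card_fin]; omega)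
      rw [← hSn]
      refine prod_div_sub_one_le_primeRatioProduct_sub_one hS (fun s hs => ?_) (by omega)
      obtain ⟨j, hj⟩ := hb s (hSU hs)
      rw [hw, ← mul_div_assoc, div_eq_one_iff_eq hdQ.ne'] at hj
      have hj' : C.b s * v j = d := by exact_mod_cast hj
      have h2 := hlt j
      by_contra! h3
      have : C.b s * v j ≤ 2 * v j := Nat.mul_le_mul_right _ (by omega)
      omega

end

theorem theorem4p1 (n : ℕ) (hn : 1 ≤ n) (f : MvPolynomial (Fin n) ℂ)
    (v : Fin n → ℕ) (d : ℕ) (hv : ∀ i, 0 < v i) (hd : 0 < d)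
    (hred : Nat.gcd (Finset.univ.gcd v) d = 1)
    (hf : MvPolynomial.IsWeightedHomogeneous v f d)
    (hsing : HasIsolatedSingularityAtZero f)
    (hhalf : ∀ i, 2 * v i ≤ d) :
    (d : ℚ) ≤ primeRatioProduct n * (milnorNumber f : ℚ) ∧
    (2 ≤ n → (∀ i, 2 * v i < d) →
      (d : ℚ) ≤ primeRatioProduct (n - 1) * (milnorNumber f : ℚ)) := by
  have hvd : ∀ i, v i < d := fun i => by have := hhalf i; have := hv i; omega
  have hμ : ∏ i, ((d : ℚ) - v i) / v i ≤ milnorNumber f := by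
    have hpos : (0 : ℚ) < ∏ i, (v i : ℚ) := Finset.prod_pos fun i _ => by exact_mod_cast hv i
    rw [Finset.prod_div_distrib, div_le_iff₀ hpos]
    have h := prod_sub_le_milnorNumber_mul_prod hv hvd hf hsing
    have hcast : ∏ i, ((d : ℚ) - v i) = ((∏ i, (d - v i) : ℕ) : ℚ) := by
      push_cast
      exact Finset.prod_congr rfl fun i _ => (Nat.cast_sub (hvd i).le).symm
    rw [hcast]
    exact_mod_cast h
  have hl : ∀ m, 0 ≤ primeRatioProduct m := fun m =>
    zero_le_one.trans ((by simp [primeRatioProduct] : (1 : ℚ) ≤ primeRatioProduct 0).trans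
      (primeRatioProduct_mono (Nat.zero_le m)))
  obtain ⟨h1, h2⟩ := le_primeRatioProduct_mul_prod hv hd hred hhalf
    (exists_mul_add_eq_of_isolatedSingularity hf hsing)
  exact ⟨h1.trans (mul_le_mul_of_nonneg_left hμ (hl _)), fun hn2 hlt =>
    (h2 hn2 hlt).trans (mul_le_mul_of_nonneg_left hμ (hl _))⟩
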